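/- Conventions. $\mathrm{PSL}(2,\mathbb C)$ acts on $\overline{\mathbb C}$ by Möbius transformations and on the upper half-space model $\mathbb H^3=\{(z,t):z\in\mathbb C,\ t>0\}$ by Poincaré extension. A family $\gamma_1,\dots,\gamma_m\in\mathrm{PSL}(2,\mathbb C)$ is a Schottky marking if there are open topological disks $D_i,D_i'$ $(1\le i\le m)$ in $\overline{\mathbb C}$, bounded by Jordan curves and with pairwise disjoint closures, such that $\gamma_i(\partial D_i)=\partial D_i'$ and $\gamma_i(D_i)\cap D_i'=\emptyset$; a group generated by a Schottky marking is a Schottky group, and $\gamma_1,\dots,\gamma_m$ are called classical generators if all these disks can be chosen to be round. Let $\mathbb B$ be the open unit ball in $\mathbb R^3$, $e=(0,0,1)$, and let $\pi:\mathbb B\to\mathbb H^3$ be the stereographic isometry $\pi(x)=-e+2(x+e)/|x+e|^2$, extended to $\mathbb R^3\cup\{\infty\}$. For $\gamma\in\mathrm{PSL}(2,\mathbb C)$ the conjugate $f=\pi^{-1}\gamma\pi$ acts on $\mathbb R^3\cup\{\infty\}$ preserving $\mathbb B$ and the unit sphere; in the ball model, "classical generators" refers to round disks in $\partial\mathbb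 B$, and the isometric sphere of $f$ is $\{x\in\mathbb R^3:|f'(x)|=1\}$. For $\gamma=\begin{pmatrix}a&b\\c&d\end{pmatrix}$ with $ad-bc=1$ and $c\neq 0$, let $z_{\gamma,\pm}=\frac{a-d\pm\sqrt{\mathrm{tr}(\gamma)^2-4}}{2c}$ be its fixed points, with the principal branch of the square root, and let $z_{\gamma,l},z_{\gamma,u}$ be the same two points labelled so that $|z_{\gamma,l}|\le|z_{\gamma,u}|$. Lemma. Let $k\ge 1$ and for every $n\in\mathbb N$ let $\alpha_{1,n},\beta_{2,n},\dots,\beta_{k,n}$ generate a Schottky group $\Gamma_n$, where $\alpha_{1,n}=\begin{pmatrix}\lambda_{1,n}&0\\0&\lambda_{1,n}^{-1}\end{pmatrix}$ with $|\lambda_{1,n}|>1$, and suppose $|\mathrm{tr}(\beta_{i,n})|\to\infty$ as $n\to\infty$ for each $2\le i\le k$. Suppose that one of the following holds: (A) there is a constant $\Lambda>1$ with $|\lambda_{1,n}|<\Lambda$ for all large $n$, and conditions (1)–(3) below hold with $R_n=|\lambda_{1,n}|$; or (B) there is a constant $\kappa>0$ with $|\lambda_{1,n}|>\kappa$ for all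 large $n$, and conditions (1)–(3) below hold with $R_n=\kappa$ for all $n$. The conditions are: (1) for all large $n$ and all $2\le i\le k$, each $\beta_{i,n}$ has its fixed points in $\mathbb C$ and $R_n^{-1}<|z_{\beta_{i,n},l}|\le|z_{\beta_{i,n},u}|<R_n$; (2) with the convention $1/0=\infty$, $$\liminf_{n\to\infty}\ \max_{2\le i\le k}\ \max\left\{\frac{1}{\big||z_{\beta_{i,n},u}|-R_n\big|\,|\mathrm{tr}(\beta_{i,n})|},\ \frac{1}{\big||z_{\beta_{i,n},l}|-R_n^{-1}\big|\,|\mathrm{tr}(\beta_{i,n})|}\right\}=0$$ (the maximum being $0$ if $k=1$); (3) for all $i\ne i'$ in $\{2,\dots,k\}$ and each of the four choices of signs $s,s'\in\{+,-\}$, $$|z_{\beta_{i,n},s}-z_{\beta_{i',n},s'}|\cdot\min\{|\mathrm{tr}(\beta_{i,n})|,|\mathrm{tr}(\beta_{i',n})|\}\to\infty\quad\text{as } n\to\infty.$$ Then there is a subsequence $(n_m)$ such that for all large $m$ the conjugates $\pi^{-1}\alpha_{1,n_m}\pi,\pi^{-1}\beta_{2,n_m}\pi,\dots,\pi^{-1}\beta_{k,n_m}\pi$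 are classical generators in the unit ball model, and moreover the $2k$ isometric spheres of these conjugates and of their inverses are pairwise disjoint. -/

import Mathlib

open Filter Topology Matrix.SpecialLinearGroup
open scoped MatrixGroups

noncomputable section

namespace SchottkyBall

/-! ### Möbius transformations and Schottky groups on the Riemann sphere -/

/-- The group `PSL(2, ℂ)`. -/
abbrev PSL2C : Type := Matrix.ProjectiveSpecialLinearGroup (Fin 2) ℂ

/-- The class in `PSL(2, ℂ)` of a matrix of determinant one. -/
def toPSL (g : SL(2, ℂ)) : PSL2C := QuotientGroup.mk g

/-- The Möbius transformation `z ↦ (a z + b) / (c z + d)` of the Riemann sphere. -/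
def moebius (g : SL(2, ℂ)) (z : OnePoint ℂ) : OnePoint ℂ := (g : GL (Fin 2) ℂ) • z

/-- An open topological disk of the Riemann sphere bounded by a closed Jordan curve. -/
def IsJordanDisk (D : Set (OnePoint ℂ)) : Prop :=
  IsOpen D ∧ IsConnected D ∧
    ∃ γ : Circle → OnePoint ℂ, Continuous γ ∧ Function.Injective γ ∧ Set.range γ = frontier D

/-- `g` is a Schottky marking: there are disks `D i`, `D' i` bounded by Jordan curves, all of them
disjoint together with their boundary curves, such that `g i` maps the boundary of `D i` onto the
boundary of `D' i`, and the image of `D i` is disjoint from `D' i`. -/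
def IsSchottkyMarking {ι : Type} (g : ι → SL(2, ℂ)) : Prop :=
  ∃ D D' : ι → Set (OnePoint ℂ),
    (∀ i, IsJordanDisk (D i)) ∧ (∀ i, IsJordanDisk (D' i)) ∧
    (∀ s t : ι ⊕ ι, s ≠ t → Disjoint (closure (Sum.elim D D' s)) (closure (Sum.elim D D' t))) ∧
    ∀ i, moebius (g i) '' frontier (D i) = frontier (D' i) ∧
      Disjoint (moebius (g i) '' D i) (D' i)

/-- The subgroup of `PSL(2, ℂ)` generated by a family of matrices. -/
def generatedBy {ι : Type} (g : ι → SL(2, ℂ)) : Subgroup PSL2C :=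
  Subgroup.closure (Set.range fun i => toPSL (g i))

/-- A Schottky group: a subgroup of `PSL(2, ℂ)` generated by some finite Schottky marking. -/
def IsSchottkyGroup (Γ : Subgroup PSL2C) : Prop :=
  ∃ (m : ℕ) (g : Fin m → SL(2, ℂ)), IsSchottkyMarking g ∧ Γ = generatedBy g

/-! ### Trace and fixed points -/

/-- The trace of a matrix in `SL(2, ℂ)`. -/
def tr (g : SL(2, ℂ)) : ℂ := (g : Matrix (Fin 2) (Fin 2) ℂ).trace

/-- The two fixed points in `ℂ` given by the quadratic formula, with the principal branch of the
square root; the sign `s = ± 1` is the sign of the square root. (Meaningful when `c ≠ 0`, that is,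
when `∞` is not fixed; otherwise both values are `0` by the convention `x / 0 = 0`.) -/
def fixedPt (g : SL(2, ℂ)) (s : ℤˣ) : ℂ :=
  (g 0 0 - g 1 1 + ((s : ℤ) : ℂ) * Complex.sqrt (tr g ^ 2 - 4)) / (2 * g 1 0)

/-- The modulus of the fixed point of smaller modulus. -/
def lowerModulus (g : SL(2, ℂ)) : ℝ := min ‖fixedPt g 1‖ ‖fixedPt g (-1)‖

/-- The modulus of the fixed point of larger modulus. -/
def upperModulus (g : SL(2, ℂ)) : ℝ := max ‖fixedPt g 1‖ ‖fixedPt g (-1)‖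

/-- The conditions on the transformations `β n i` relative to the annuli
`{ (R n)⁻¹ < |z| < R n }`. -/
structure AnnulusConditions {k : ℕ} (β : ℕ → Fin k → SL(2, ℂ)) (R : ℕ → ℝ) : Prop where
  /-- For large `n` the fixed points lie in the annulus. -/
  mem_annulus : ∀ᶠ n in atTop, ∀ i,
    (R n)⁻¹ < lowerModulus (β n i) ∧ lowerModulus (β n i) ≤ upperModulus (β n i) ∧
      upperModulus (β n i) < R n
  /-- The lower limit of the largest of the quantities `1 / (|dist. to the boundary| |tr|)` is
  zero, with values in `[0, ∞]` and `1 / 0 = ∞`. -/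
  boundary : liminf (fun n => ⨆ i,
      max ‖(upperModulus (β n i) - R n) * ‖tr (β n i)‖‖ₑ⁻¹
          ‖(lowerModulus (β n i) - (R n)⁻¹) * ‖tr (β n i)‖‖ₑ⁻¹) atTop = 0
  /-- The mutual distances of fixed points, times the smaller of the traces, tend to infinity. -/
  separation : ∀ i j, i ≠ j → ∀ s t : ℤˣ,
    Tendsto (fun n => ‖fixedPt (β n i) s - fixedPt (β n j) t‖ * min ‖tr (β n i)‖ ‖tr (β n j)‖)
      atTop atTop

/-! ### Hyperbolic space: the upper half-space model and the unit ball model -/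

/-- Euclidean three-space as `ℂ × ℝ` with the Euclidean norm. The upper half-space is
`{(z, t) | 0 < t}`, the unit ball is `{x | ‖x‖ < 1}`. -/
abbrev E3 : Type := WithLp 2 (ℂ × ℝ)

/-- The point of `E3` with coordinates `(z, t)`. -/
def mk3 (z : ℂ) (t : ℝ) : E3 := WithLp.toLp 2 (z, t)

/-- The north pole `(0, 0, 1)`. -/
def pole : E3 := mk3 0 1

/-- Poincaré extension of a Möbius transformation to `ℝ³ ∪ {∞}`, which acts on the upper half-space
as an orientation preserving isometry:
`(z, t) ↦ (((a z + b) conj (c z + d) + a conj c t²) / N, t / N)` with `N = |c z + d|² + |c|² t²`. -/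
def poincareExt (g : SL(2, ℂ)) : OnePoint E3 → OnePoint E3
  | none => if g 1 0 = 0 then OnePoint.infty else ((mk3 (g 0 0 / g 1 0) 0 : E3) : OnePoint E3)
  | some x =>
    let z : ℂ := x.fst
    let t : ℝ := x.snd
    let N : ℝ := ‖g 1 0 * z + g 1 1‖ ^ 2 + ‖g 1 0‖ ^ 2 * t ^ 2
    if N = 0 then OnePoint.infty
    else ((mk3 (((g 0 0 * z + g 0 1) * star (g 1 0 * z + g 1 1)
      + g 0 0 * star (g 1 0) * (t : ℂ) ^ 2) / (N : ℂ)) (t / N) : E3) : OnePoint E3)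

open scoped Classical in
/-- The stereographic map between the unit ball and the upper half-space, extended to `ℝ³ ∪ {∞}`:
the inversion `x ↦ -e + 2 (x + e) / |x + e|²` in the sphere of radius `√2` centred at the south
pole `-e`. It exchanges the ball and the upper half-space, is an isometry between the two models,
and is its own inverse. -/
def stereo : OnePoint E3 → OnePoint E3
  | none => ((-pole : E3) : OnePoint E3)
  | some x => if x = -pole then OnePoint.infty
    else ((EuclideanGeometry.inversion (-pole) (Real.sqrt 2) x : E3) : OnePoint E3)

/-- The conjugate by the stereographic map: the action of `g` in the unit ball model, as a Möbius
transformation of `ℝ³ ∪ {∞}`. -/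
def ballAction (g : SL(2, ℂ)) (x : OnePoint E3) : OnePoint E3 :=
  stereo (poincareExt g (stereo x))

/-- The map `ℝ³ → ℝ³` underlying a map of `ℝ³ ∪ {∞}` (the value at the pole is irrelevant). -/
def finitePart (f : OnePoint E3 → OnePoint E3) (x : E3) : E3 :=
  match f x with
  | none => 0
  | some y => y

/-- The isometric sphere `{x ∈ ℝ³ | |f'(x)| = 1}` of a Möbius transformation of `ℝ³ ∪ {∞}`.
(At the pole `f` is not differentiable and the derivative is `0` by convention.) -/
def isometricSphere (f : OnePoint E3 → OnePoint E3) : Set E3 :=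
  {x | ‖fderiv ℝ (finitePart f) x‖ = 1}

/-- The circle in the unit sphere with centre direction `v` at height `h`. -/
def sphereCircle (v : E3) (h : ℝ) : Set E3 := {x | ‖x‖ = 1 ∧ inner ℝ v x = h}

/-- The open round disk in the unit sphere bounded by `sphereCircle v h` and containing `v`. -/
def sphereDisk (v : E3) (h : ℝ) : Set E3 := {x | ‖x‖ = 1 ∧ h < inner ℝ v x}

/-- `f` is a family of classical generators in the unit ball model: there are round disks `D i`,
`D' i` in the unit sphere, all of them disjoint together with their boundary circles, such that
`f i` maps the boundary circle of `D i` onto that of `D' i`, and the image of `D i` is disjoint from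
`D' i`. -/
def AreClassicalGenerators {ι : Type} (f : ι → OnePoint E3 → OnePoint E3) : Prop :=
  ∃ (v v' : ι → E3) (h h' : ι → ℝ),
    (∀ i, ‖v i‖ = 1 ∧ -1 < h i ∧ h i < 1) ∧ (∀ i, ‖v' i‖ = 1 ∧ -1 < h' i ∧ h' i < 1) ∧
    (∀ s t : ι ⊕ ι, s ≠ t →
      Disjoint
        (sphereDisk (Sum.elim v v' s) (Sum.elim h h' s) ∪
          sphereCircle (Sum.elim v v' s) (Sum.elim h h' s))
        (sphereDisk (Sum.elim v v' t) (Sum.elim h h' t) ∪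
          sphereCircle (Sum.elim v v' t) (Sum.elim h h' t))) ∧
    ∀ i, f i '' ((↑) '' sphereCircle (v i) (h i)) = (↑) '' sphereCircle (v' i) (h' i) ∧
      Disjoint (f i '' ((↑) '' sphereDisk (v i) (h i))) ((↑) '' sphereDisk (v' i) (h' i))

/-- The isometric spheres of all `g i` and all `(g i)⁻¹` in the unit ball model are pairwise
disjoint. -/
def HaveDisjointIsometricSpheres {ι : Type} (g : ι → SL(2, ℂ)) : Prop :=
  ∀ s t : ι ⊕ ι, s ≠ t →
    Disjoint (isometricSphere (ballAction (Sum.elim g (fun i => (g i)⁻¹) s)))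
      (isometricSphere (ballAction (Sum.elim g (fun i => (g i)⁻¹) t)))

end SchottkyBall

end

noncomputable section

namespace SchottkyBall

/-! ### Contracted vectors -/

/-! Write a point of the Riemann sphere as `[x : y]`. In the spherical metric the derivative of `g`
there is `|v|² / |g v|²` with `v = (x, y)`, so in the ball model the closed isometric disk of `g` is
the set of directions that `g` contracts. The action of `g` carries its isometric circle onto that
of `g⁻¹` and its isometric disk off that of `g⁻¹`. Hence classical generation follows once no
nonzero vector is contracted by two of the `α^{±1}`, `β_i^{±1}`. The isometric spheres are then
disjoint too, since radial projection sends each of them into its isometric disk.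

To locate contracted vectors, let `u` be an eigenvector of `g` with eigenvalue `μ`, `|μ| ≤ 1`. As
`det g = 1`, `v ∧ u = μ (g v ∧ u)`, so a contracted `v` satisfies `|v ∧ u| ≤ |μ| |v| |u|`, with `|μ|
≤ 2 / |tr g|`. Thus the disks of `β_i^{±1}` have size `O(1 / |tr|)` around the fixed points
(`exists_fixedPt_near`), while those of the diagonal generator are exactly `|z| ≤ 1/|λ|` and `|z| ≥
|λ|`. Condition (2) keeps the former away from the latter, condition (3) keeps different `β_i`
apart, and `|tr| > 2` separates `β_i` from its inverse. Condition (2) is a lower limit, so all this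
holds for infinitely many `n`, which gives the subsequence.

The geometric half identifies the isometric sphere, defined through `fderiv`, by an explicit
conformal factor (`dist_finitePart_ballAction`, `mul_norm_hasFDerivAt_sq`). -/

/-- The squared norm of the image of the vector `(x, y)` under `g`. -/
def imageNormSq (g : SL(2, ℂ)) (x y : ℂ) : ℝ :=
  ‖g 0 0 * x + g 0 1 * y‖ ^ 2 + ‖g 1 0 * x + g 1 1 * y‖ ^ 2

/-- `g` does not increase the norm of the vector `(x, y)`. -/
def Contracts (g : SL(2, ℂ)) (x y : ℂ) : Prop :=
  imageNormSq g x y ≤ ‖x‖ ^ 2 + ‖y‖ ^ 2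

/-- No nonzero vector is contracted by two members of the family of all `g i` and `(g i)⁻¹`. -/
def HaveDisjointContractedVectors {ι : Type} (g : ι → SL(2, ℂ)) : Prop :=
  ∀ s t : ι ⊕ ι, s ≠ t → ∀ x y : ℂ, Contracts (Sum.elim g (fun i => (g i)⁻¹) s) x y →
    Contracts (Sum.elim g (fun i => (g i)⁻¹) t) x y → x = 0 ∧ y = 0

lemma det_eq_one (g : SL(2, ℂ)) : g 0 0 * g 1 1 - g 0 1 * g 1 0 = 1 := by
  rw [← Matrix.det_fin_two, g.det_coe]

@[simp] lemma inv_apply_zero_zero (g : SL(2, ℂ)) : g⁻¹ 0 0 = g 1 1 := by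
  simp [coe_inv, Matrix.adjugate_fin_two]

@[simp] lemma inv_apply_zero_one (g : SL(2, ℂ)) : g⁻¹ 0 1 = -g 0 1 := by
  simp [coe_inv, Matrix.adjugate_fin_two]

@[simp] lemma inv_apply_one_zero (g : SL(2, ℂ)) : g⁻¹ 1 0 = -g 1 0 := by
  simp [coe_inv, Matrix.adjugate_fin_two]

@[simp] lemma inv_apply_one_one (g : SL(2, ℂ)) : g⁻¹ 1 1 = g 0 0 := by
  simp [coe_inv, Matrix.adjugate_fin_two]

lemma tr_eq (g : SL(2, ℂ)) : tr g = g 0 0 + g 1 1 := Matrix.trace_fin_two _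

lemma sqrt_sq (z : ℂ) : Complex.sqrt z ^ 2 = z := by
  simp [Complex.sqrt]

/-- The parallelogram bound `‖u + v‖ ^ 2 ≤ 2 (‖u‖ ^ 2 + ‖v‖ ^ 2)`. -/
lemma norm_add_sq_le_two (u v : ℂ) : ‖u + v‖ ^ 2 ≤ 2 * (‖u‖ ^ 2 + ‖v‖ ^ 2) := by
  have := norm_add_le u v
  nlinarith [sq_nonneg (‖u‖ - ‖v‖), norm_nonneg (u + v), norm_nonneg u, norm_nonneg v]

/-- By Cayley–Hamilton `g + g⁻¹ = tr g`, so the parallelogram bound gives `|tr g|² |v|² ≤ 4 |v|²`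
for a vector contracted by both. -/
lemma eq_zero_of_contracts_inv {g : SL(2, ℂ)} (hg : 2 < ‖tr g‖) {x y : ℂ}
    (h : Contracts g x y) (h' : Contracts g⁻¹ x y) : x = 0 ∧ y = 0 := by
  unfold Contracts imageNormSq at h h'
  simp only [inv_apply_zero_zero, inv_apply_zero_one, inv_apply_one_zero, inv_apply_one_one] at h'
  have h1 := norm_add_sq_le_two (g 0 0 * x + g 0 1 * y) (g 1 1 * x + -g 0 1 * y)
  have h2 := norm_add_sq_le_two (g 1 0 * x + g 1 1 * y) (-g 1 0 * x + g 0 0 * y)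
  rw [show g 0 0 * x + g 0 1 * y + (g 1 1 * x + -g 0 1 * y) = tr g * x by rw [tr_eq]; ring,
    norm_mul, mul_pow] at h1
  rw [show g 1 0 * x + g 1 1 * y + (-g 1 0 * x + g 0 0 * y) = tr g * y by rw [tr_eq]; ring,
    norm_mul, mul_pow] at h2
  have h3 : (‖tr g‖ ^ 2 - 4) * (‖x‖ ^ 2 + ‖y‖ ^ 2) ≤ 0 := by nlinarith
  have h4 : 0 < ‖tr g‖ ^ 2 - 4 := by nlinarith
  have h5 : ‖x‖ ^ 2 + ‖y‖ ^ 2 ≤ 0 := nonpos_of_mul_nonpos_right h3 h4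
  constructor <;> rw [← norm_eq_zero] <;> nlinarith [norm_nonneg x, norm_nonneg y]

/-- Cauchy–Schwarz for the determinant of two vectors. -/
lemma norm_wedge_sq_le (x y u v : ℂ) :
    ‖x * v - y * u‖ ^ 2 ≤ (‖x‖ ^ 2 + ‖y‖ ^ 2) * (‖u‖ ^ 2 + ‖v‖ ^ 2) := by
  have h := norm_sub_le (x * v) (y * u)
  rw [norm_mul, norm_mul] at h
  have : ‖x * v - y * u‖ ^ 2 ≤ (‖x‖ * ‖v‖ + ‖y‖ * ‖u‖) ^ 2 := by gcongr
  nlinarith [sq_nonneg (‖x‖ * ‖u‖ - ‖y‖ * ‖v‖)]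

/-- A vector contracted by `g` is close to every eigenvector of small eigenvalue. -/
lemma Contracts.norm_wedge_sq_le {g : SL(2, ℂ)} {x y : ℂ} (h : Contracts g x y) {u v μ : ℂ}
    (hu : g 0 0 * u + g 0 1 * v = μ * u) (hv : g 1 0 * u + g 1 1 * v = μ * v) :
    ‖x * v - y * u‖ ^ 2 ≤ ‖μ‖ ^ 2 * ((‖x‖ ^ 2 + ‖y‖ ^ 2) * (‖u‖ ^ 2 + ‖v‖ ^ 2)) := by
  -- A matrix of determinant one preserves the wedge of two vectors, and `(u, v)` is multiplied by
  -- `μ`.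
  have h1 : x * v - y * u
      = μ * ((g 0 0 * x + g 0 1 * y) * v - (g 1 0 * x + g 1 1 * y) * u) := by
    linear_combination (-(x * v - y * u)) * det_eq_one g
      + (g 1 0 * x + g 1 1 * y) * (-hu) + (g 0 0 * x + g 0 1 * y) * hv
  rw [h1, norm_mul, mul_pow]
  gcongr
  refine (SchottkyBall.norm_wedge_sq_le _ _ u v).trans ?_
  exact mul_le_mul_of_nonneg_right h (by positivity)

/-! ### Eigenvalues and fixed points -/

/-- The eigenvalue belonging to the fixed point `fixedPt g s`. -/
def fixedEigenvalue (g : SL(2, ℂ)) (s : ℤˣ) : ℂ :=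
  (tr g + ((s : ℤ) : ℂ) * Complex.sqrt (tr g ^ 2 - 4)) / 2

lemma units_cast_sq (s : ℤˣ) : ((s : ℤ) : ℂ) ^ 2 = 1 := by
  rcases Int.units_eq_one_or s with rfl | rfl <;> simp

lemma fixedEigenvalue_mul_neg (g : SL(2, ℂ)) (s : ℤˣ) :
    fixedEigenvalue g s * fixedEigenvalue g (-s) = 1 := by
  unfold fixedEigenvalue
  push_cast
  linear_combination (-(1 / 4)) * Complex.sqrt (tr g ^ 2 - 4) ^ 2 * units_cast_sq s
    - (1 / 4) * sqrt_sq (tr g ^ 2 - 4)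

lemma fixedEigenvalue_add_neg (g : SL(2, ℂ)) (s : ℤˣ) :
    fixedEigenvalue g s + fixedEigenvalue g (-s) = tr g := by
  unfold fixedEigenvalue
  push_cast
  ring

lemma fixedPt_eigen {g : SL(2, ℂ)} (hc : g 1 0 ≠ 0) (s : ℤˣ) :
    g 0 0 * fixedPt g s + g 0 1 * 1 = fixedEigenvalue g s * fixedPt g s ∧
    g 1 0 * fixedPt g s + g 1 1 * 1 = fixedEigenvalue g s * 1 := by
  unfold fixedEigenvalue fixedPt
  have hw := sqrt_sq (tr g ^ 2 - 4)
  generalize Complex.sqrt (tr g ^ 2 - 4) = w at *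
  rw [tr_eq] at *
  constructor
  · field_simp
    linear_combination -4 * det_eq_one g - hw - w ^ 2 * units_cast_sq s
  · field_simp
    ring

/-- One of the two eigenvalues is small. -/
lemma exists_norm_fixedEigenvalue_mul_le {g : SL(2, ℂ)} (hg : 2 < ‖tr g‖) :
    ∃ s, ‖fixedEigenvalue g s‖ * ‖tr g‖ ≤ 2 := by
  -- The eigenvalues are `μ` and `1/μ`, so `|μ| |tr g| ≤ |μ|² + 1 ≤ 2` when `|μ| ≤ 1`.
  have key : ∀ s, ‖fixedEigenvalue g s‖ ≤ 1 → ‖fixedEigenvalue g s‖ * ‖tr g‖ ≤ 2 := by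
    intro s hs
    have h1 : ‖fixedEigenvalue g s‖ * ‖fixedEigenvalue g (-s)‖ = 1 := by
      rw [← norm_mul, fixedEigenvalue_mul_neg, norm_one]
    have h2 : ‖tr g‖ ≤ ‖fixedEigenvalue g s‖ + ‖fixedEigenvalue g (-s)‖ := by
      rw [← fixedEigenvalue_add_neg g s]
      exact norm_add_le _ _
    nlinarith [norm_nonneg (fixedEigenvalue g s)]
  by_contra! hne
  have h1 : 1 < ‖fixedEigenvalue g 1‖ := by
    by_contra! h
    exact (hne 1).not_ge (key 1 h)
  have h2 : 1 < ‖fixedEigenvalue g (-1)‖ := by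
    by_contra! h
    exact (hne (-1)).not_ge (key (-1) h)
  have h3 : ‖fixedEigenvalue g 1‖ * ‖fixedEigenvalue g (-1)‖ = 1 := by
    rw [← norm_mul, fixedEigenvalue_mul_neg, norm_one]
  nlinarith

/-- Vectors contracted by `g` are close to a fixed point of `g`. -/
lemma exists_fixedPt_near {g : SL(2, ℂ)} (hc : g 1 0 ≠ 0) (hg : 2 < ‖tr g‖) {x y : ℂ}
    (h : Contracts g x y ∨ Contracts g⁻¹ x y) :
    ∃ s, (‖x - y * fixedPt g s‖ * ‖tr g‖) ^ 2
      ≤ 4 * ((‖x‖ ^ 2 + ‖y‖ ^ 2) * (‖fixedPt g s‖ ^ 2 + 1)) := by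
  obtain ⟨s, hs⟩ := exists_norm_fixedEigenvalue_mul_le hg
  have hpos : ∀ s, 0 ≤ (‖x‖ ^ 2 + ‖y‖ ^ 2) * (‖fixedPt g s‖ ^ 2 + 1) := fun s => by positivity
  have hsq : (‖fixedEigenvalue g s‖ * ‖tr g‖) ^ 2 ≤ 4 := by
    have : 0 ≤ ‖fixedEigenvalue g s‖ * ‖tr g‖ := by positivity
    nlinarith
  rcases h with h | h
  · refine ⟨s, ?_⟩
    have h1 := h.norm_wedge_sq_le (fixedPt_eigen hc s).1 (fixedPt_eigen hc s).2
    rw [mul_one, norm_one, one_pow] at h1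
    calc _ = ‖x - y * fixedPt g s‖ ^ 2 * ‖tr g‖ ^ 2 := mul_pow _ _ _
      _ ≤ _ := mul_le_mul_of_nonneg_right h1 (sq_nonneg _)
      _ = (‖fixedEigenvalue g s‖ * ‖tr g‖) ^ 2
          * ((‖x‖ ^ 2 + ‖y‖ ^ 2) * (‖fixedPt g s‖ ^ 2 + 1)) := by ring
      _ ≤ _ := mul_le_mul_of_nonneg_right hsq (hpos s)
  -- Inversion exchanges the eigenvalues: `g⁻¹` acts by the small one on the eigenvector of the
  -- other fixed point.
  · refine ⟨-s, ?_⟩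
    obtain ⟨e1, e2⟩ := fixedPt_eigen hc (-s)
    have ht := (fixedEigenvalue_add_neg g s).trans (tr_eq g)
    have h1 := h.norm_wedge_sq_le (u := fixedPt g (-s)) (v := 1) (μ := fixedEigenvalue g s)
      (by simp only [inv_apply_zero_zero, inv_apply_zero_one]
          linear_combination -e1 - fixedPt g (-s) * ht)
      (by simp only [inv_apply_one_zero, inv_apply_one_one]
          linear_combination -e2 - ht)
    rw [mul_one, norm_one, one_pow] at h1
    calc _ = ‖x - y * fixedPt g (-s)‖ ^ 2 * ‖tr g‖ ^ 2 := mul_pow _ _ _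
      _ ≤ _ := mul_le_mul_of_nonneg_right h1 (sq_nonneg _)
      _ = (‖fixedEigenvalue g s‖ * ‖tr g‖) ^ 2
          * ((‖x‖ ^ 2 + ‖y‖ ^ 2) * (‖fixedPt g (-s)‖ ^ 2 + 1)) := by ring
      _ ≤ _ := mul_le_mul_of_nonneg_right hsq (hpos (-s))

/-! ### Contraction by the diagonal generator -/

lemma norm_mul_le_of_contracts_diagonal {a : SL(2, ℂ)} {l : ℂ}
    (ha : (a : Matrix (Fin 2) (Fin 2) ℂ) = !![l, 0; 0, l⁻¹]) (hl : 1 < ‖l‖) {x y : ℂ}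
    (h : Contracts a x y) : ‖l‖ * ‖x‖ ≤ ‖y‖ := by
  have h0 : 0 < ‖l‖ := one_pos.trans hl
  simp only [Contracts, imageNormSq, ha, Matrix.of_apply, Matrix.cons_val', Matrix.cons_val_zero,
    Matrix.cons_val_one, Matrix.cons_val_fin_one, zero_mul, add_zero, zero_add, norm_mul, norm_inv,
    mul_pow] at h
  have hm : ‖l‖ * ‖l‖⁻¹ = 1 := mul_inv_cancel₀ h0.ne'
  have h2 : (‖l‖ ^ 2 - 1) * ((‖l‖ * ‖x‖) ^ 2 - ‖y‖ ^ 2) ≤ 0 := by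
    have := mul_le_mul_of_nonneg_left h (sq_nonneg ‖l‖)
    have e : ‖l‖ ^ 2 * (‖l‖⁻¹ ^ 2 * ‖y‖ ^ 2) = ‖y‖ ^ 2 := by
      linear_combination (‖l‖ * ‖l‖⁻¹ + 1) * ‖y‖ ^ 2 * hm
    rw [mul_add, e] at this
    nlinarith
  have h3 : (‖l‖ * ‖x‖) ^ 2 - ‖y‖ ^ 2 ≤ 0 := nonpos_of_mul_nonpos_right h2 (by nlinarith)
  exact le_of_sq_le_sq (by linarith) (norm_nonneg y)

lemma norm_mul_le_of_contracts_diagonal_inv {a : SL(2, ℂ)} {l : ℂ}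
    (ha : (a : Matrix (Fin 2) (Fin 2) ℂ) = !![l, 0; 0, l⁻¹]) (hl : 1 < ‖l‖) {x y : ℂ}
    (h : Contracts a⁻¹ x y) : ‖l‖ * ‖y‖ ≤ ‖x‖ := by
  refine norm_mul_le_of_contracts_diagonal ha hl (x := y) (y := x) ?_
  simp only [Contracts, imageNormSq, inv_apply_zero_zero, inv_apply_zero_one, inv_apply_one_zero,
    inv_apply_one_one] at h ⊢
  have h1 : a 0 1 = 0 := by simp [ha]
  have h2 : a 1 0 = 0 := by simp [ha]
  simp only [h1, h2, neg_zero, zero_mul, add_zero, zero_add] at h ⊢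
  linarith

/-! ### Estimates that separate the contracted regions -/

lemma eq_zero_of_norm_sq_le {K A : ℝ} {x : ℂ} (h : K ^ 2 * ‖x‖ ^ 2 ≤ A * ‖x‖ ^ 2)
    (hA : A < K ^ 2) : x = 0 := by
  by_contra hx
  have : 0 < ‖x‖ ^ 2 := by positivity
  nlinarith

/-- Here `[x : y]` lies in `|z| ≤ 1/R` and also within `O(1/T)` of `p`, which is too far outside
that disk. Homogeneous coordinates make the point at infinity harmless. The threshold `4 (L + 1) ^
2` is chosen to serve all three separation lemmas. -/
lemma eq_zero_of_close_of_small {x y p : ℂ} {R L T : ℝ} (hR : 1 < R) (hRL : R ≤ L) (hT : 0 ≤ T)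
    (hx : R * ‖x‖ ≤ ‖y‖) (hp : 4 * (L + 1) ^ 2 < (‖p‖ - R⁻¹) * T) (hpL : ‖p‖ ≤ L)
    (h : (‖x - y * p‖ * T) ^ 2 ≤ 4 * ((‖x‖ ^ 2 + ‖y‖ ^ 2) * (‖p‖ ^ 2 + 1))) : x = 0 ∧ y = 0 := by
  have hR0 : 0 < R := by linarith
  have hxy : ‖x‖ ≤ ‖y‖ := by nlinarith [norm_nonneg x]
  have hx' : ‖x‖ ≤ R⁻¹ * ‖y‖ := by rw [inv_mul_eq_div, le_div_iff₀ hR0]; linarith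
  have h1 : (‖p‖ - R⁻¹) * ‖y‖ ≤ ‖x - y * p‖ := by
    have := norm_sub_norm_le (y * p) x
    rw [norm_sub_rev, norm_mul] at this
    nlinarith
  have h2 : 4 * (L + 1) ^ 2 * ‖y‖ ≤ ‖x - y * p‖ * T := by
    nlinarith [mul_le_mul_of_nonneg_right hp.le (norm_nonneg y), mul_le_mul_of_nonneg_right h1 hT]
  have h3 : (4 * (L + 1) ^ 2 * ‖y‖) ^ 2 ≤ (‖x - y * p‖ * T) ^ 2 := by gcongr
  have hy : y = 0 := by
    refine eq_zero_of_norm_sq_le (K := 4 * (L + 1) ^ 2) (A := 8 * (L ^ 2 + 1)) ?_ ?_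
    · have : (‖x‖ ^ 2 + ‖y‖ ^ 2) * (‖p‖ ^ 2 + 1) ≤ (2 * ‖y‖ ^ 2) * (L ^ 2 + 1) := by
        gcongr
        nlinarith [norm_nonneg x]
      linarith [mul_pow (4 * (L + 1) ^ 2) ‖y‖ 2]
    · have hL : 1 < L := by linarith
      have : L ^ 2 + 1 < (L + 1) ^ 2 := by nlinarith
      nlinarith
  subst hy
  exact ⟨norm_le_zero_iff.1 (by simpa using hxy), rfl⟩

lemma eq_zero_of_close_of_large {x y p : ℂ} {R L T : ℝ} (hR : 1 < R) (hRL : R ≤ L) (hT : 0 ≤ T)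
    (hx : R * ‖y‖ ≤ ‖x‖) (hp : 4 * (L + 1) ^ 2 < (R - ‖p‖) * T) (hpL : ‖p‖ ≤ L)
    (h : (‖x - y * p‖ * T) ^ 2 ≤ 4 * ((‖x‖ ^ 2 + ‖y‖ ^ 2) * (‖p‖ ^ 2 + 1))) : x = 0 ∧ y = 0 := by
  have hR0 : 0 < R := by linarith
  have hxy : ‖y‖ ≤ ‖x‖ := by nlinarith [norm_nonneg y]
  have h1 : (R - ‖p‖) * ‖x‖ ≤ L * ‖x - y * p‖ := by
    have := norm_sub_norm_le x (y * p)
    rw [norm_mul] at this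
    -- From `|x - y p| ≥ |x| - |y| |p| ≥ (1 - |p| / R) |x|`; the factor `R` is then absorbed into
    -- `L`.
    have : (R - ‖p‖) * ‖x‖ ≤ R * ‖x - y * p‖ := by nlinarith [norm_nonneg p]
    exact this.trans (mul_le_mul_of_nonneg_right hRL (norm_nonneg _))
  have h2 : 4 * (L + 1) ^ 2 * ‖x‖ ≤ L * (‖x - y * p‖ * T) := by
    nlinarith [mul_le_mul_of_nonneg_right hp.le (norm_nonneg x), mul_le_mul_of_nonneg_right h1 hT]
  have h3 : (4 * (L + 1) ^ 2 * ‖x‖) ^ 2 ≤ (L * (‖x - y * p‖ * T)) ^ 2 := by gcongr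
  rw [mul_pow L] at h3
  have hx : x = 0 := by
    refine eq_zero_of_norm_sq_le (K := 4 * (L + 1) ^ 2) (A := 8 * (L ^ 2 * (L ^ 2 + 1))) ?_ ?_
    · have : (‖x‖ ^ 2 + ‖y‖ ^ 2) * (‖p‖ ^ 2 + 1) ≤ (2 * ‖x‖ ^ 2) * (L ^ 2 + 1) := by
        gcongr
        nlinarith [norm_nonneg y]
      have := mul_le_mul_of_nonneg_left (h.trans (mul_le_mul_of_nonneg_left this zero_le_four))
        (sq_nonneg L)
      linarith [mul_pow (4 * (L + 1) ^ 2) ‖x‖ 2]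
    · have hL : 1 < L := by linarith
      have e1 : L ^ 2 + 1 < (L + 1) ^ 2 := by nlinarith
      have e2 : L ^ 2 * (L ^ 2 + 1) ≤ (L + 1) ^ 2 * (L + 1) ^ 2 := by
        gcongr
        linarith
      nlinarith [sq_nonneg ((L + 1) ^ 2), sq_pos_of_pos (show 0 < (L + 1) ^ 2 by positivity)]
  subst hx
  exact ⟨rfl, norm_le_zero_iff.1 (by simpa using hxy)⟩

/-- The forms `x - y p` and `x - y q` are both small; eliminating `x` or `y` between them bounds `(p
- q) y` and `(p - q) x`. -/
lemma eq_zero_of_close_of_close {x y p q : ℂ} {L S T : ℝ} (hS : 0 ≤ S) (hT : 0 ≤ T)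
    (hp : ‖p‖ ≤ L) (hq : ‖q‖ ≤ L) (hpq : 4 * (L + 1) ^ 2 < ‖p - q‖ * min S T)
    (h : (‖x - y * p‖ * S) ^ 2 ≤ 4 * ((‖x‖ ^ 2 + ‖y‖ ^ 2) * (‖p‖ ^ 2 + 1)))
    (h' : (‖x - y * q‖ * T) ^ 2 ≤ 4 * ((‖x‖ ^ 2 + ‖y‖ ^ 2) * (‖q‖ ^ 2 + 1))) :
    x = 0 ∧ y = 0 := by
  set m := min S T with hm
  have hm0 : 0 ≤ m := le_min hS hT
  have hL : 0 ≤ L := (norm_nonneg p).trans hp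
  set W := ‖x‖ ^ 2 + ‖y‖ ^ 2 with hW
  have hW0 : 0 ≤ W := by positivity
  have hP : (‖x - y * p‖ * m) ^ 2 ≤ 4 * (W * (L ^ 2 + 1)) := by
    refine le_trans ?_ (h.trans ?_)
    · gcongr
      exact min_le_left _ _
    · gcongr
  have hQ : (‖x - y * q‖ * m) ^ 2 ≤ 4 * (W * (L ^ 2 + 1)) := by
    refine le_trans ?_ (h'.trans ?_)
    · gcongr
      exact min_le_right _ _
    · gcongr
  have hy : (‖p - q‖ * m) ^ 2 * ‖y‖ ^ 2 ≤ 16 * (W * (L ^ 2 + 1)) := by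
    have e : ‖p - q‖ * m * ‖y‖ ≤ ‖x - y * p‖ * m + ‖x - y * q‖ * m := by
      have := norm_sub_le (x - y * q) (x - y * p)
      rw [show x - y * q - (x - y * p) = (p - q) * y by ring, norm_mul] at this
      nlinarith
    have : (‖p - q‖ * m * ‖y‖) ^ 2 ≤ (‖x - y * p‖ * m + ‖x - y * q‖ * m) ^ 2 := by gcongr
    nlinarith [sq_nonneg (‖x - y * p‖ * m - ‖x - y * q‖ * m)]
  have hx : (‖p - q‖ * m) ^ 2 * ‖x‖ ^ 2 ≤ 16 * (L ^ 2 * (W * (L ^ 2 + 1))) := by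
    have e : ‖p - q‖ * m * ‖x‖ ≤ L * (‖x - y * p‖ * m + ‖x - y * q‖ * m) := by
      have := norm_sub_le (p * (x - y * q)) (q * (x - y * p))
      rw [show p * (x - y * q) - q * (x - y * p) = (p - q) * x by ring, norm_mul, norm_mul,
        norm_mul] at this
      have e1 := mul_le_mul_of_nonneg_right hp (norm_nonneg (x - y * q))
      have e2 := mul_le_mul_of_nonneg_right hq (norm_nonneg (x - y * p))
      have := mul_le_mul_of_nonneg_right (this.trans (add_le_add e1 e2)) hm0
      linarith
    have e2 : (‖p - q‖ * m * ‖x‖) ^ 2 ≤ (L * (‖x - y * p‖ * m + ‖x - y * q‖ * m)) ^ 2 := by gcongr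
    have e3 : (‖x - y * p‖ * m + ‖x - y * q‖ * m) ^ 2 ≤ 16 * (W * (L ^ 2 + 1)) := by
      nlinarith [sq_nonneg (‖x - y * p‖ * m - ‖x - y * q‖ * m)]
    rw [mul_pow L] at e2
    have := mul_le_mul_of_nonneg_left e3 (sq_nonneg L)
    linarith [mul_pow (‖p - q‖ * m) ‖x‖ 2]
  -- The two bounds add up to the factor `(1 + L²)(L² + 1)`.
  have hsum : (‖p - q‖ * m) ^ 2 * W ≤ 16 * (L ^ 2 + 1) ^ 2 * W := by
    rw [hW] at hx hy ⊢
    linarith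
  have hlt : 16 * (L ^ 2 + 1) ^ 2 < (‖p - q‖ * m) ^ 2 := by
    have : L ^ 2 + 1 ≤ (L + 1) ^ 2 := by nlinarith
    calc 16 * (L ^ 2 + 1) ^ 2 ≤ 16 * ((L + 1) ^ 2) ^ 2 := by gcongr
      _ = (4 * (L + 1) ^ 2) ^ 2 := by ring
      _ < _ := by gcongr
  have hz : W ≤ 0 := by nlinarith
  constructor <;> rw [← norm_eq_zero] <;> nlinarith [norm_nonneg x, norm_nonneg y]

/-! ### Quantitative separation for a single group -/

/-- Quantitative form of the conditions, for a single group. -/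
structure IsWellSeparated {k : ℕ} (β : Fin k → SL(2, ℂ)) (R L : ℝ) : Prop where
  pos : 0 < R
  le : R ≤ L
  tr_large : ∀ i, 2 < ‖tr (β i)‖
  lower : ∀ i, R⁻¹ < lowerModulus (β i)
  upper : ∀ i, upperModulus (β i) < R
  lower_large : ∀ i, 4 * (L + 1) ^ 2 < (lowerModulus (β i) - R⁻¹) * ‖tr (β i)‖
  upper_large : ∀ i, 4 * (L + 1) ^ 2 < (R - upperModulus (β i)) * ‖tr (β i)‖
  separated : ∀ i j, i ≠ j → ∀ s t : ℤˣ, 4 * (L + 1) ^ 2 <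
    ‖fixedPt (β i) s - fixedPt (β j) t‖ * min ‖tr (β i)‖ ‖tr (β j)‖

lemma lowerModulus_le (g : SL(2, ℂ)) (s : ℤˣ) : lowerModulus g ≤ ‖fixedPt g s‖ := by
  rcases Int.units_eq_one_or s with rfl | rfl
  exacts [min_le_left _ _, min_le_right _ _]

lemma le_upperModulus (g : SL(2, ℂ)) (s : ℤˣ) : ‖fixedPt g s‖ ≤ upperModulus g := by
  rcases Int.units_eq_one_or s with rfl | rfl
  exacts [le_max_left _ _, le_max_right _ _]

namespace IsWellSeparated

variable {k : ℕ} {β : Fin k → SL(2, ℂ)} {R L : ℝ}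

/-- The index is needed: for an empty family nothing prevents `R ≤ 1`. -/
lemma one_lt (h : IsWellSeparated β R L) (i : Fin k) : 1 < R := by
  have h1 : R⁻¹ < R :=
    ((h.lower i).trans_le ((lowerModulus_le _ 1).trans (le_upperModulus _ 1))).trans (h.upper i)
  by_contra! h2
  have := (one_le_inv₀ h.pos).2 h2
  linarith

/-- If `c = 0`, both values of `fixedPt` are `0` by the division convention, outside the annulus. -/
lemma ne_zero (h : IsWellSeparated β R L) (i : Fin k) : β i 1 0 ≠ 0 := by
  intro hc
  have h1 := h.lower i
  have h2 : lowerModulus (β i) = 0 := by simp [lowerModulus, fixedPt, hc]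
  have := inv_pos.2 h.pos
  linarith

lemma norm_fixedPt_le (h : IsWellSeparated β R L) (i : Fin k) (s : ℤˣ) : ‖fixedPt (β i) s‖ ≤ L :=
  ((le_upperModulus _ s).trans (h.upper i).le).trans h.le

lemma disjoint_diagonal (h : IsWellSeparated β R L) {l : ℂ} (hl : 1 < ‖l‖) (hRl : R ≤ ‖l‖)
    {a : SL(2, ℂ)} (ha : (a : Matrix (Fin 2) (Fin 2) ℂ) = !![l, 0; 0, l⁻¹]) (i : Fin k) {x y : ℂ}
    (h1 : Contracts a x y ∨ Contracts a⁻¹ x y)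
    (h2 : Contracts (β i) x y ∨ Contracts (β i)⁻¹ x y) : x = 0 ∧ y = 0 := by
  obtain ⟨s, hs⟩ := exists_fixedPt_near (h.ne_zero i) (h.tr_large i) h2
  rcases h1 with h1 | h1
  · refine eq_zero_of_close_of_small (h.one_lt i) h.le (norm_nonneg _) ?_ ?_
      (h.norm_fixedPt_le i s) hs
    · exact (mul_le_mul_of_nonneg_right hRl (norm_nonneg x)).trans
        (norm_mul_le_of_contracts_diagonal ha hl h1)
    · refine (h.lower_large i).trans_le ?_
      gcongr
      exact lowerModulus_le _ s
  · refine eq_zero_of_close_of_large (h.one_lt i) h.le (norm_nonneg _) ?_ ?_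
      (h.norm_fixedPt_le i s) hs
    · exact (mul_le_mul_of_nonneg_right hRl (norm_nonneg y)).trans
        (norm_mul_le_of_contracts_diagonal_inv ha hl h1)
    · refine (h.upper_large i).trans_le ?_
      gcongr
      exact le_upperModulus _ s

lemma disjoint_of_ne (h : IsWellSeparated β R L) {i j : Fin k} (hij : i ≠ j) {x y : ℂ}
    (h1 : Contracts (β i) x y ∨ Contracts (β i)⁻¹ x y)
    (h2 : Contracts (β j) x y ∨ Contracts (β j)⁻¹ x y) : x = 0 ∧ y = 0 := by
  obtain ⟨s, hs⟩ := exists_fixedPt_near (h.ne_zero i) (h.tr_large i) h1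
  obtain ⟨t, ht⟩ := exists_fixedPt_near (h.ne_zero j) (h.tr_large j) h2
  exact eq_zero_of_close_of_close (norm_nonneg _) (norm_nonneg _) (h.norm_fixedPt_le i s)
    (h.norm_fixedPt_le j t) (h.separated i j hij s t) hs ht

/-- The quantitative conditions imply that the isometric disks are disjoint. -/
lemma haveDisjointContractedVectors (h : IsWellSeparated β R L) {l : ℂ} (hl : 1 < ‖l‖)
    (hRl : R ≤ ‖l‖) {a : SL(2, ℂ)} (ha : (a : Matrix (Fin 2) (Fin 2) ℂ) = !![l, 0; 0, l⁻¹]) :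
    HaveDisjointContractedVectors (Fin.cons a β : Fin (k + 1) → SL(2, ℂ)) := by
  have key : ∀ i x y, Contracts ((Fin.cons a β : Fin (k + 1) → SL(2, ℂ)) i) x y →
      Contracts ((Fin.cons a β : Fin (k + 1) → SL(2, ℂ)) i)⁻¹ x y → x = 0 ∧ y = 0 := by
    intro i x y h1 h2
    induction i using Fin.cases with
    | zero =>
      -- The trace of the diagonal generator may be small (`λ` near `i`), so `|λ| > 1` is used
      -- instead of the trace criterion.
      have e1 := norm_mul_le_of_contracts_diagonal ha hl h1
      have e2 := norm_mul_le_of_contracts_diagonal_inv ha hl h2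
      constructor <;> rw [← norm_eq_zero] <;> nlinarith [norm_nonneg x, norm_nonneg y]
    | succ i => exact eq_zero_of_contracts_inv (h.tr_large i) h1 h2
  have key2 : ∀ i j, i ≠ j → ∀ x y,
      (Contracts ((Fin.cons a β : Fin (k + 1) → SL(2, ℂ)) i) x y ∨
        Contracts ((Fin.cons a β : Fin (k + 1) → SL(2, ℂ)) i)⁻¹ x y) →
      (Contracts ((Fin.cons a β : Fin (k + 1) → SL(2, ℂ)) j) x y ∨
        Contracts ((Fin.cons a β : Fin (k + 1) → SL(2, ℂ)) j)⁻¹ x y) → x = 0 ∧ y = 0 := by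
    intro i j hij x y h1 h2
    induction i using Fin.cases with
    | zero =>
      induction j using Fin.cases with
      | zero => exact absurd rfl hij
      | succ j => exact h.disjoint_diagonal hl hRl ha j h1 h2
    | succ i =>
      induction j using Fin.cases with
      | zero => exact h.disjoint_diagonal hl hRl ha i h2 h1
      | succ j => exact h.disjoint_of_ne (fun e => hij (congrArg Fin.succ e)) h1 h2
  rintro (i | i) (j | j) hst x y h1 h2
  · exact key2 i j (fun e => hst (e ▸ rfl)) x y (.inl h1) (.inl h2)
  · rcases eq_or_ne i j with rfl | hij
    exacts [key i x y h1 h2, key2 i j hij x y (.inl h1) (.inr h2)]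
  · rcases eq_or_ne i j with rfl | hij
    exacts [key i x y h2 h1, key2 i j hij x y (.inr h1) (.inl h2)]
  · exact key2 i j (fun e => hst (e ▸ rfl)) x y (.inr h1) (.inr h2)

end IsWellSeparated

/-- The asymptotic conditions imply the quantitative ones infinitely often. -/
lemma AnnulusConditions.frequently_isWellSeparated {k : ℕ} {β : ℕ → Fin k → SL(2, ℂ)} {R : ℕ → ℝ}
    {L : ℝ} (h : AnnulusConditions β R) (hR : ∀ᶠ n in atTop, 0 < R n)
    (hRL : ∀ᶠ n in atTop, R n ≤ L)
    (htr : ∀ i, Tendsto (fun n => ‖tr (β n i)‖) atTop atTop) :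
    ∃ᶠ n in atTop, IsWellSeparated (β n) (R n) L := by
  set K : ℝ := 4 * (L + 1) ^ 2
  have hK : 0 ≤ K := by positivity
  have hpos : (0 : ENNReal) < (ENNReal.ofReal (K + 1))⁻¹ := by simp
  -- Only this bound is merely frequent; all the other requirements hold eventually.
  have hfreq := frequently_lt_of_liminf_lt (by isBoundedDefault) (h.boundary.trans_lt hpos)
  have e1 : ∀ᶠ n in atTop, ∀ i, 2 < ‖tr (β n i)‖ :=
    eventually_all.2 fun i => (htr i).eventually_gt_atTop 2
  have e2 : ∀ᶠ n in atTop, ∀ i j, i ≠ j → ∀ s t : ℤˣ, K <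
      ‖fixedPt (β n i) s - fixedPt (β n j) t‖ * min ‖tr (β n i)‖ ‖tr (β n j)‖ := by
    refine eventually_all.2 fun i => eventually_all.2 fun j => ?_
    by_cases hij : i = j
    · exact .of_forall fun n hne => absurd hij hne
    · have : ∀ s t : ℤˣ, ∀ᶠ n in atTop, K <
          ‖fixedPt (β n i) s - fixedPt (β n j) t‖ * min ‖tr (β n i)‖ ‖tr (β n j)‖ :=
        fun s t => (h.separation i j hij s t).eventually_gt_atTop K
      filter_upwards [eventually_all.2 fun s => eventually_all.2 (this s)] with n hn _
      exact hn
  refine (hfreq.and_eventually (hR.and (hRL.and (h.mem_annulus.and (e1.and e2))))).mono ?_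
  rintro n ⟨hb, hpos, hle, hm, ht, hs⟩
  have hbound : ∀ r : ℝ, ‖r‖ₑ⁻¹ < (ENNReal.ofReal (K + 1))⁻¹ → K < |r| := by
    intro r hr
    rw [ENNReal.inv_lt_inv, Real.enorm_eq_ofReal_abs, ENNReal.ofReal_lt_ofReal_iff'] at hr
    linarith [hr.1]
  have hi := fun i => max_lt_iff.1 ((le_iSup _ i).trans_lt hb)
  refine ⟨hpos, hle, ht, fun i => (hm i).1, fun i => (hm i).2.2, fun i => ?_, fun i => ?_, hs⟩
  · have := hbound _ (hi i).2
    rwa [abs_mul, abs_of_pos (sub_pos.2 (hm i).1), abs_of_nonneg (norm_nonneg _)] at this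
  · have := hbound _ (hi i).1
    rwa [abs_mul, abs_sub_comm, abs_of_pos (sub_pos.2 (hm i).2.2),
      abs_of_nonneg (norm_nonneg _)] at this

/-! ### Coordinates -/

@[simp] lemma mk3_fst (z : ℂ) (t : ℝ) : (mk3 z t).fst = z := rfl

@[simp] lemma mk3_snd (z : ℂ) (t : ℝ) : (mk3 z t).snd = t := rfl

lemma E3_ext {x y : E3} (h1 : x.fst = y.fst) (h2 : x.snd = y.snd) : x = y :=
  WithLp.ofLp_injective 2 (Prod.ext h1 h2)

lemma norm_sq_E3 (x : E3) : ‖x‖ ^ 2 = ‖x.fst‖ ^ 2 + x.snd ^ 2 := by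
  rw [WithLp.prod_norm_sq_eq_of_L2, Real.norm_eq_abs, sq_abs]

lemma inner_E3 (x y : E3) :
    inner ℝ x y = x.fst.re * y.fst.re + x.fst.im * y.fst.im + x.snd * y.snd := by
  rw [WithLp.prod_inner_apply]
  simp [Complex.inner]
  ring

lemma dist_pole_sq (x : E3) : dist x (-pole) ^ 2 = ‖x.fst‖ ^ 2 + (x.snd + 1) ^ 2 := by
  rw [dist_eq_norm, norm_sq_E3]
  simp [pole]

lemma eq_neg_pole_iff (x : E3) : x = -pole ↔ x.fst = 0 ∧ x.snd = -1 :=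
  ⟨by rintro rfl; simp [pole], fun h => E3_ext (by simp [pole, h.1]) (by simp [pole, h.2])⟩

/-! ### The stereographic map -/

/-- The inversion underlying `stereo`. -/
def inv3 (x : E3) : E3 := EuclideanGeometry.inversion (-pole) (Real.sqrt 2) x

lemma stereo_infty : stereo OnePoint.infty = ((-pole : E3) : OnePoint E3) := rfl

lemma stereo_coe_neg_pole : stereo ((-pole : E3) : OnePoint E3) = OnePoint.infty := by
  change (if (-pole : E3) = -pole then _ else _) = _
  simp

lemma stereo_coe {x : E3} (hx : x ≠ -pole) : stereo (x : OnePoint E3) = (inv3 x : E3) := by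
  change (if x = -pole then _ else _) = _
  rw [if_neg hx, inv3]

lemma inv3_eq (x : E3) :
    inv3 x = mk3 ((2 / dist x (-pole) ^ 2 : ℝ) * x.fst)
      (2 / dist x (-pole) ^ 2 * (x.snd + 1) - 1) := by
  have h : (Real.sqrt 2 / dist x (-pole)) ^ 2 = 2 / dist x (-pole) ^ 2 := by
    rw [div_pow, Real.sq_sqrt zero_le_two]
  rw [inv3, EuclideanGeometry.inversion, h]
  apply E3_ext <;> simp [pole, sub_eq_add_neg, mul_add]

lemma dist_inv3_neg_pole (x : E3) : dist (inv3 x) (-pole) = 2 / dist x (-pole) := by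
  rw [inv3, EuclideanGeometry.dist_inversion_center, Real.sq_sqrt zero_le_two]

lemma dist_inv3_inv3 {x y : E3} (hx : x ≠ -pole) (hy : y ≠ -pole) :
    dist (inv3 x) (inv3 y) = 2 / (dist x (-pole) * dist y (-pole)) * dist x y := by
  rw [inv3, inv3, EuclideanGeometry.dist_inversion_inversion hx hy, Real.sq_sqrt zero_le_two]

lemma inv3_inv3 (x : E3) : inv3 (inv3 x) = x :=
  EuclideanGeometry.inversion_inversion _ (by positivity) x

lemma inv3_ne_neg_pole {x : E3} (hx : x ≠ -pole) : inv3 x ≠ -pole := by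
  rw [← dist_ne_zero, dist_inv3_neg_pole]
  have := dist_ne_zero.2 hx
  positivity

lemma stereo_stereo (x : OnePoint E3) : stereo (stereo x) = x := by
  induction x with
  | infty => rw [stereo_infty, stereo_coe_neg_pole]
  | coe x =>
    by_cases hx : x = -pole
    · rw [hx, stereo_coe_neg_pole, stereo_infty]
    · rw [stereo_coe hx, stereo_coe (inv3_ne_neg_pole hx), inv3_inv3]

/-! ### The boundary sphere -/

/-- The point of the boundary of the upper half-space with homogeneous coordinates `[x : y]`. -/
def boundaryPt (x y : ℂ) : OnePoint E3 :=
  if y = 0 then OnePoint.infty else ((mk3 (x / y) 0 : E3) : OnePoint E3)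

/-- The point of the unit sphere with homogeneous coordinates `[x : y]`. -/
def spherePt (x y : ℂ) : E3 :=
  mk3 (2 * x * star y / ((‖x‖ ^ 2 + ‖y‖ ^ 2 : ℝ) : ℂ))
    ((‖y‖ ^ 2 - ‖x‖ ^ 2) / (‖x‖ ^ 2 + ‖y‖ ^ 2))

lemma normSq_pos {x y : ℂ} (h : ¬(x = 0 ∧ y = 0)) : 0 < ‖x‖ ^ 2 + ‖y‖ ^ 2 := by
  rw [not_and_or] at h
  rcases h with h | h
  · have := norm_pos_iff.2 h
    positivity
  · have := norm_pos_iff.2 h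
    positivity

lemma stereo_boundaryPt {x y : ℂ} (h : ¬(x = 0 ∧ y = 0)) :
    stereo (boundaryPt x y) = (spherePt x y : E3) := by
  have hW := normSq_pos h
  by_cases hy : y = 0
  · subst hy
    rw [boundaryPt, if_pos rfl, stereo_infty]
    congr 1
    refine ((eq_neg_pole_iff _).2 ⟨by simp [spherePt], ?_⟩).symm
    have : ‖x‖ ^ 2 ≠ 0 := by simpa using hW.ne'
    simp only [spherePt, mk3_snd, norm_zero]
    field_simp
    simp
  · have hne : mk3 (x / y) 0 ≠ -pole := by simp [eq_neg_pole_iff]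
    rw [boundaryPt, if_neg hy, stereo_coe hne, inv3_eq, dist_pole_sq]
    have hy' : 0 < ‖y‖ ^ 2 := by have := norm_pos_iff.2 hy; positivity
    have e : 2 / (‖x / y‖ ^ 2 + (0 + 1) ^ 2) = 2 * ‖y‖ ^ 2 / (‖x‖ ^ 2 + ‖y‖ ^ 2) := by
      rw [norm_div, div_pow]
      field_simp
      ring
    have hWc : ((‖x‖ ^ 2 + ‖y‖ ^ 2 : ℝ) : ℂ) ≠ 0 := by exact_mod_cast hW.ne'
    simp only [mk3_fst, mk3_snd, e, spherePt]
    congr 2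
    · have hm : y * star y = ((‖y‖ ^ 2 : ℝ) : ℂ) := by
        rw [Complex.star_def, Complex.mul_conj']; norm_cast
      rw [Complex.ofReal_div, Complex.ofReal_mul, ← hm]
      field_simp
      norm_cast
      ring
    · field_simp
      ring

lemma stereo_spherePt {x y : ℂ} (h : ¬(x = 0 ∧ y = 0)) :
    stereo (spherePt x y : E3) = boundaryPt x y := by
  rw [← stereo_boundaryPt h, stereo_stereo]

lemma norm_spherePt {x y : ℂ} (h : ¬(x = 0 ∧ y = 0)) : ‖spherePt x y‖ = 1 := by
  have hW := normSq_pos h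
  rw [← sq_eq_sq₀ (norm_nonneg _) zero_le_one, norm_sq_E3]
  simp only [spherePt, mk3_fst, mk3_snd, norm_div, norm_mul, norm_star, Complex.norm_real,
    Complex.norm_ofNat, Real.norm_eq_abs, abs_of_pos hW]
  field_simp
  ring

lemma exists_spherePt {p : E3} (hp : ‖p‖ = 1) :
    ∃ x y : ℂ, ¬(x = 0 ∧ y = 0) ∧ p = spherePt x y := by
  by_cases h : p = -pole
  · refine ⟨1, 0, by simp, ?_⟩
    rw [h, eq_comm, eq_neg_pole_iff]
    simp [spherePt]
  · have h1 : ‖p.fst‖ ^ 2 + p.snd ^ 2 = 1 := by rw [← norm_sq_E3, hp, one_pow]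
    have h2 : p.snd + 1 ≠ 0 := by
      intro h0
      have h3 : p.snd = -1 := by linarith
      refine h ((eq_neg_pole_iff p).2 ⟨?_, h3⟩)
      rw [← norm_eq_zero, ← sq_eq_zero_iff]
      nlinarith
    -- Stereographic projection from `-pole` has the ratio `p.fst / (p.snd + 1)`.
    refine ⟨p.fst, ((p.snd + 1 : ℝ) : ℂ), fun h0 => h2 (by exact_mod_cast h0.2), ?_⟩
    have e : ‖p.fst‖ ^ 2 + ‖((p.snd + 1 : ℝ) : ℂ)‖ ^ 2 = 2 * (p.snd + 1) := by
      rw [Complex.norm_real, Real.norm_eq_abs, sq_abs]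
      linarith
    have h2c : ((p.snd + 1 : ℝ) : ℂ) ≠ 0 := by exact_mod_cast h2
    apply E3_ext
    · simp only [spherePt, mk3_fst]
      rw [e, Complex.star_def, Complex.conj_ofReal, Complex.ofReal_mul, Complex.ofReal_ofNat]
      field_simp
    · simp only [spherePt, mk3_snd]
      rw [e, Complex.norm_real, Real.norm_eq_abs, sq_abs]
      field_simp
      linarith

lemma poincareExt_infty (g : SL(2, ℂ)) : poincareExt g OnePoint.infty =
    if g 1 0 = 0 then OnePoint.infty else ((mk3 (g 0 0 / g 1 0) 0 : E3) : OnePoint E3) := rfl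

/-- The denominator of the Poincaré extension. -/
def extDenom (g : SL(2, ℂ)) (w : E3) : ℝ :=
  ‖g 1 0 * w.fst + g 1 1‖ ^ 2 + ‖g 1 0‖ ^ 2 * w.snd ^ 2

/-- The first numerator of the Poincaré extension. -/
def extNum (g : SL(2, ℂ)) (w : E3) : ℂ :=
  (g 0 0 * w.fst + g 0 1) * star (g 1 0 * w.fst + g 1 1)
    + g 0 0 * star (g 1 0) * (w.snd : ℂ) ^ 2

lemma poincareExt_coe_of_eq {g : SL(2, ℂ)} {w : E3} (h : extDenom g w = 0) :
    poincareExt g (w : OnePoint E3) = OnePoint.infty := if_pos h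

lemma poincareExt_coe_of_ne {g : SL(2, ℂ)} {w : E3} (h : extDenom g w ≠ 0) :
    poincareExt g (w : OnePoint E3)
      = ((mk3 (extNum g w / extDenom g w) (w.snd / extDenom g w) : E3) : OnePoint E3) :=
  if_neg h

lemma poincareExt_boundaryPt (g : SL(2, ℂ)) {x y : ℂ} (h : ¬(x = 0 ∧ y = 0)) :
    poincareExt g (boundaryPt x y)
      = boundaryPt (g 0 0 * x + g 0 1 * y) (g 1 0 * x + g 1 1 * y) := by
  by_cases hy : y = 0
  · subst hy
    have hx : x ≠ 0 := by simpa using h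
    rw [boundaryPt, if_pos rfl, poincareExt_infty, boundaryPt]
    simp only [mul_zero, add_zero, mul_eq_zero, hx, or_false, mul_div_mul_right _ _ hx]
  · have e0 : g 1 0 * (x / y) + g 1 1 = (g 1 0 * x + g 1 1 * y) / y := by field_simp
    have e : extDenom g (mk3 (x / y) 0) = ‖(g 1 0 * x + g 1 1 * y) / y‖ ^ 2 := by
      simp [extDenom, e0]
    rw [boundaryPt, if_neg hy, boundaryPt]
    split_ifs with h0
    · exact poincareExt_coe_of_eq (by rw [e, h0]; simp)
    · rw [poincareExt_coe_of_ne (by rw [e]; simp [h0, hy])]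
      congr 2
      · have hs : star ((g 1 0 * x + g 1 1 * y) / y) ≠ 0 := star_ne_zero.2 (div_ne_zero h0 hy)
        have hm : ((‖(g 1 0 * x + g 1 1 * y) / y‖ ^ 2 : ℝ) : ℂ)
            = (g 1 0 * x + g 1 1 * y) / y * star ((g 1 0 * x + g 1 1 * y) / y) := by
          rw [Complex.star_def, Complex.mul_conj']; norm_cast
        rw [e, hm, extNum]
        simp only [mk3_fst, mk3_snd, e0, Complex.ofReal_zero]
        rw [zero_pow two_ne_zero, mul_zero, add_zero, mul_div_mul_right _ _ hs]
        field_simp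
      · simp

lemma image_ne_zero (g : SL(2, ℂ)) {x y : ℂ} (h : ¬(x = 0 ∧ y = 0)) :
    ¬(g 0 0 * x + g 0 1 * y = 0 ∧ g 1 0 * x + g 1 1 * y = 0) := by
  rintro ⟨h1, h2⟩
  have hd := det_eq_one g
  refine h ⟨?_, ?_⟩
  · linear_combination (-x) * hd + g 1 1 * h1 - g 0 1 * h2
  · linear_combination (-y) * hd - g 1 0 * h1 + g 0 0 * h2

lemma ballAction_spherePt (g : SL(2, ℂ)) {x y : ℂ} (h : ¬(x = 0 ∧ y = 0)) :
    ballAction g (spherePt x y : E3)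
      = (spherePt (g 0 0 * x + g 0 1 * y) (g 1 0 * x + g 1 1 * y) : E3) := by
  rw [ballAction, stereo_spherePt h, poincareExt_boundaryPt g h,
    stereo_boundaryPt (image_ne_zero g h)]

/-! ### Isometric circles -/

/-- The squared Frobenius norm. -/
def frobSq (g : SL(2, ℂ)) : ℝ := ‖g 0 0‖ ^ 2 + ‖g 0 1‖ ^ 2 + ‖g 1 0‖ ^ 2 + ‖g 1 1‖ ^ 2

/-- A vector pointing from the origin to the centre of the isometric sphere. -/
def axis (g : SL(2, ℂ)) : E3 :=
  mk3 (-2 * star (g 0 0 * star (g 0 1) + g 1 0 * star (g 1 1)))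
    (‖g 0 0‖ ^ 2 + ‖g 1 0‖ ^ 2 - (‖g 0 1‖ ^ 2 + ‖g 1 1‖ ^ 2))

/-- Up to sign, `axis g` is the vector of the traceless part of the Hermitian matrix `g* g`, so `|g
v|² / |v|²` is an affine function on the sphere and isometric disks are round caps. -/
lemma inner_axis_spherePt (g : SL(2, ℂ)) {x y : ℂ} (h : ¬(x = 0 ∧ y = 0)) :
    inner ℝ (axis g) (spherePt x y)
      = frobSq g - 2 * imageNormSq g x y / (‖x‖ ^ 2 + ‖y‖ ^ 2) := by
  have hW := normSq_pos h
  have e : spherePt x y = (‖x‖ ^ 2 + ‖y‖ ^ 2)⁻¹ • mk3 (2 * x * star y) (‖y‖ ^ 2 - ‖x‖ ^ 2) := by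
    apply E3_ext
    · simp [spherePt, div_eq_inv_mul]
    · simp [spherePt, div_eq_inv_mul]
  rw [e, inner_smul_right, inv_mul_eq_div, div_eq_iff hW.ne', sub_mul, div_mul_cancel₀ _ hW.ne',
    inner_E3]
  simp only [axis, mk3_fst, mk3_snd, frobSq, imageNormSq, Complex.sq_norm, Complex.normSq_apply,
    Complex.star_def, Complex.add_re, Complex.add_im, Complex.mul_re, Complex.mul_im,
    Complex.conj_re, Complex.conj_im, Complex.neg_re, Complex.neg_im, Complex.re_ofNat,
    Complex.im_ofNat]
  ring

/-- This is the discriminant of `g* g`, which has trace `frobSq g` and determinant one. -/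
lemma norm_axis_sq (g : SL(2, ℂ)) : ‖axis g‖ ^ 2 = frobSq g ^ 2 - 4 := by
  have h1 := congrArg Complex.re (det_eq_one g)
  have h2 := congrArg Complex.im (det_eq_one g)
  rw [norm_sq_E3]
  simp only [axis, mk3_fst, mk3_snd, frobSq, norm_mul, mul_pow, norm_star]
  simp only [Complex.sub_re, Complex.sub_im, Complex.one_re, Complex.one_im, Complex.sq_norm,
    Complex.normSq_apply, Complex.star_def, Complex.add_re, Complex.add_im, Complex.mul_re,
    Complex.mul_im, Complex.conj_re, Complex.conj_im, Complex.neg_re, Complex.neg_im,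
    Complex.re_ofNat, Complex.im_ofNat] at *
  linear_combination (-4) * ((g 0 0).re * (g 1 1).re - (g 0 0).im * (g 1 1).im
    - ((g 0 1).re * (g 1 0).re - (g 0 1).im * (g 1 0).im) + 1) * h1
    - 4 * ((g 0 0).re * (g 1 1).im + (g 0 0).im * (g 1 1).re
    - ((g 0 1).re * (g 1 0).im + (g 0 1).im * (g 1 0).re)) * h2

/-! ### Distances under the Poincaré extension -/

/-- The finite branch of the Poincaré extension. -/
def ext3 (g : SL(2, ℂ)) (w : E3) : E3 := mk3 (extNum g w / extDenom g w) (w.snd / extDenom g w)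

/-- The squared norm of the image of `(w, 1)` under `g`, for a point `w` of the upper half-space. -/
def extNormSq (g : SL(2, ℂ)) (w : E3) : ℝ :=
  ‖g 0 0 * w.fst + g 0 1‖ ^ 2 + ‖g 0 0‖ ^ 2 * w.snd ^ 2 + extDenom g w

/-- With the quaternion `w = z + t j`, `extNum + t j` is `(a w + b)` times the conjugate of `c w +
d`; the identity is multiplicativity of the norm. -/
lemma extNum_norm_sq (g : SL(2, ℂ)) (w : E3) : ‖extNum g w‖ ^ 2 + w.snd ^ 2
    = (extNormSq g w - extDenom g w) * extDenom g w := by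
  have h1 := det_eq_one g
  have h2 := congrArg star h1
  apply Complex.ofReal_injective
  simp only [extNormSq, extDenom, extNum]
  push_cast
  simp only [← Complex.mul_conj', Complex.star_def, map_sub, map_add, map_mul, map_pow, map_one,
    Complex.conj_conj, Complex.conj_ofReal] at *
  generalize (starRingEnd ℂ) (g 0 0) = A, (starRingEnd ℂ) (g 0 1) = B,
    (starRingEnd ℂ) (g 1 0) = C, (starRingEnd ℂ) (g 1 1) = D, (w.snd : ℂ) = t at *
  linear_combination (-t ^ 2 * (A * D - B * C)) * h1 - t ^ 2 * h2

/-- Supplies the cross term in the distance formula `dist_ext3_sq`. -/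
lemma extNum_polar (g : SL(2, ℂ)) (w w' : E3) :
    (extNormSq g w - extDenom g w) * extDenom g w'
      + (extNormSq g w' - extDenom g w') * extDenom g w
      - 2 * (extNum g w * star (extNum g w')).re
      = ‖w.fst - w'.fst‖ ^ 2 + w.snd ^ 2 + w'.snd ^ 2 := by
  have h1 := det_eq_one g
  have h2 := congrArg star h1
  apply Complex.ofReal_injective
  simp only [extNormSq, extDenom, extNum]
  push_cast
  rw [Complex.re_eq_add_conj]
  simp only [← Complex.mul_conj', Complex.star_def, map_sub, map_add, map_mul, map_pow, map_one,
    Complex.conj_conj, Complex.conj_ofReal] at *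
  generalize (starRingEnd ℂ) (g 0 0) = A, (starRingEnd ℂ) (g 0 1) = B,
    (starRingEnd ℂ) (g 1 0) = C, (starRingEnd ℂ) (g 1 1) = D, (starRingEnd ℂ) w.fst = Z,
    (starRingEnd ℂ) w'.fst = Z', (w.snd : ℂ) = t, (w'.snd : ℂ) = t' at *
  linear_combination ((w.fst - w'.fst) * (Z - Z') + t ^ 2 + t' ^ 2) * ((A * D - B * C) * h1 + h2)

lemma dist_sq_E3 (x y : E3) : dist x y ^ 2 = ‖x.fst - y.fst‖ ^ 2 + (x.snd - y.snd) ^ 2 := by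
  rw [dist_eq_norm, norm_sq_E3]
  rfl

lemma dist_ext3_sq {g : SL(2, ℂ)} {w w' : E3} (h : extDenom g w ≠ 0) (h' : extDenom g w' ≠ 0) :
    extDenom g w * extDenom g w' * dist (ext3 g w) (ext3 g w') ^ 2 = dist w w' ^ 2 := by
  have e1 := extNum_norm_sq g w
  have e2 := extNum_norm_sq g w'
  have e3 := extNum_polar g w w'
  have e4 : ‖extNum g w / extDenom g w - extNum g w' / extDenom g w'‖ ^ 2
      = ‖extNum g w‖ ^ 2 / extDenom g w ^ 2 + ‖extNum g w'‖ ^ 2 / extDenom g w' ^ 2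
        - 2 * (extNum g w * star (extNum g w')).re / (extDenom g w * extDenom g w') := by
    rw [Complex.sq_norm, Complex.normSq_sub, ← Complex.sq_norm, ← Complex.sq_norm, norm_div, norm_div, div_pow, div_pow, Complex.norm_real,
      Complex.norm_real, Real.norm_eq_abs, Real.norm_eq_abs, sq_abs, sq_abs, map_div₀,
      Complex.conj_ofReal, div_mul_div_comm, ← Complex.ofReal_mul, Complex.div_ofReal_re,
      Complex.star_def, mul_div_assoc]
  rw [dist_sq_E3, dist_sq_E3]
  simp only [ext3, mk3_fst, mk3_snd]
  rw [e4]
  field_simp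
  linear_combination (extDenom g w') ^ 2 * e1 + (extDenom g w) ^ 2 * e2
    + extDenom g w * extDenom g w' * e3

lemma extDenom_mul_dist_ext3 {g : SL(2, ℂ)} {w : E3} (h : extDenom g w ≠ 0) :
    extDenom g w * dist (ext3 g w) (-pole) ^ 2 = extNormSq g w + 2 * w.snd := by
  have e1 := extNum_norm_sq g w
  rw [dist_pole_sq]
  simp only [ext3, mk3_fst, mk3_snd, norm_div, Complex.norm_real, Real.norm_eq_abs, div_pow, sq_abs]
  field_simp
  linear_combination e1

/-! ### The conformal factor and the equation of the isometric sphere -/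

/-- Up to the factor `4`, the reciprocal of the conformal factor of `ballAction g`. -/
def confDenom (g : SL(2, ℂ)) (x : E3) : ℝ :=
  frobSq g * (‖x‖ ^ 2 + 1) - 2 * inner ℝ (axis g) x + 2 * (1 - ‖x‖ ^ 2)

/-- The right side collects the factors of the two inversions and the Poincaré extension; the left
side is a polynomial, hence continuous at the exceptional points too. -/
lemma confDenom_eq (g : SL(2, ℂ)) {x : E3} (hx : x ≠ -pole) :
    confDenom g x
      = dist x (-pole) ^ 2 * (extNormSq g (inv3 x) + 2 * (inv3 x).snd) := by
  have hq : dist x (-pole) ^ 2 ≠ 0 := pow_ne_zero 2 (dist_ne_zero.2 hx)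
  have hr : 2 / dist x (-pole) ^ 2 * dist x (-pole) ^ 2 = 2 := div_mul_cancel₀ _ hq
  rw [inv3_eq, confDenom, norm_sq_E3, inner_E3]
  generalize 2 / dist x (-pole) ^ 2 = r at *
  rw [dist_pole_sq] at *
  simp only [axis, extNormSq, extDenom, mk3_fst, mk3_snd, frobSq, Complex.sq_norm,
    Complex.normSq_apply, Complex.star_def, Complex.add_re, Complex.add_im, Complex.mul_re,
    Complex.mul_im, Complex.conj_re, Complex.conj_im, Complex.neg_re, Complex.neg_im,
    Complex.re_ofNat, Complex.im_ofNat, Complex.ofReal_re, Complex.ofReal_im] at *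
  generalize (g 0 0).re = a, (g 0 0).im = a', (g 0 1).re = b, (g 0 1).im = b', (g 1 0).re = c,
    (g 1 0).im = c', (g 1 1).re = d, (g 1 1).im = d', x.fst.re = z, x.fst.im = z', x.snd = t at *
  set q := z * z + z' * z' + (t + 1) ^ 2
  linear_combination (-((a * a + a' * a' + c * c + c' * c') * (r * q + 2 - 2 * (t + 1))
    + 2 * ((a * b + a' * b' + c * d + c' * d') * z + (a * b' - a' * b + c * d' - c' * d) * z')
    + 2 * (t + 1))) * hr

/-- The set of points where `ballAction g` is not given by the composition of the finite branches
of its factors. -/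
def exceptionalSet (g : SL(2, ℂ)) : Set E3 :=
  {x | x = -pole ∨ extDenom g (inv3 x) = 0 ∨
    (extDenom g (inv3 x) ≠ 0 ∧ ext3 g (inv3 x) = -pole)}

/-- Each condition holds at one point at most: the denominator vanishes only over `-d/c`, and `ext3
g` is injective off its pole. -/
lemma exceptionalSet_finite (g : SL(2, ℂ)) : (exceptionalSet g).Finite := by
  have hinj : Function.Injective inv3 := Function.LeftInverse.injective inv3_inv3
  have h1 : {w | extDenom g w = 0}.Subsingleton := by
    have key : ∀ w : E3, extDenom g w = 0 → g 1 0 * w.fst + g 1 1 = 0 ∧ g 1 0 ≠ 0 ∧ w.snd = 0 := by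
      intro w hw
      rw [extDenom, add_eq_zero_iff_of_nonneg (by positivity) (by positivity)] at hw
      have e : g 1 0 * w.fst + g 1 1 = 0 := by simpa using hw.1
      have hc : g 1 0 ≠ 0 := by
        intro hc
        have hd := det_eq_one g
        rw [hc, zero_mul, zero_add] at e
        simp [hc, e] at hd
      exact ⟨e, hc, by simpa [hc] using hw.2⟩
    intro w hw w' hw'
    obtain ⟨e1, hc, e2⟩ := key w hw
    obtain ⟨e1', -, e2'⟩ := key w' hw'
    exact E3_ext (mul_left_cancel₀ hc (by linear_combination e1 - e1')) (e2.trans e2'.symm)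
  have h2 : {w | extDenom g w ≠ 0 ∧ ext3 g w = -pole}.Subsingleton := by
    rintro w ⟨hw, ew⟩ w' ⟨hw', ew'⟩
    have := dist_ext3_sq hw hw'
    rw [ew, ew', dist_self, zero_pow two_ne_zero, mul_zero] at this
    exact dist_eq_zero.1 (sq_eq_zero_iff.1 this.symm)
  exact (Set.finite_singleton (-pole)).union
    ((h1.finite.preimage hinj.injOn).union (h2.finite.preimage hinj.injOn))

lemma finitePart_ballAction {g : SL(2, ℂ)} {x : E3} (hx : x ∉ exceptionalSet g) :
    finitePart (ballAction g) x = inv3 (ext3 g (inv3 x)) := by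
  simp only [exceptionalSet, Set.mem_ofPred_eq, not_or, not_and] at hx
  have e : ballAction g (x : OnePoint E3) = (inv3 (ext3 g (inv3 x)) : E3) := by
    rw [ballAction, stereo_coe hx.1, poincareExt_coe_of_ne hx.2.1]
    exact stereo_coe (hx.2.2 hx.2.1)
  rw [finitePart, e]

/-- `ballAction g` is conformal, with explicit conformal factor. -/
lemma dist_finitePart_ballAction {g : SL(2, ℂ)} {x y : E3} (hx : x ∉ exceptionalSet g)
    (hy : y ∉ exceptionalSet g) :
    confDenom g x * confDenom g y
      * dist (finitePart (ballAction g) x) (finitePart (ballAction g) y) ^ 2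
      = 16 * dist x y ^ 2 := by
  rw [finitePart_ballAction hx, finitePart_ballAction hy]
  simp only [exceptionalSet, Set.mem_ofPred_eq, not_or, not_and] at hx hy
  obtain ⟨hx1, hx2, hx3⟩ := hx
  obtain ⟨hy1, hy2, hy3⟩ := hy
  have hx3 := hx3 hx2
  have hy3 := hy3 hy2
  rw [confDenom_eq g hx1, confDenom_eq g hy1, dist_inv3_inv3 hx3 hy3,
    ← extDenom_mul_dist_ext3 hx2, ← extDenom_mul_dist_ext3 hy2]
  have h1 := dist_ext3_sq hx2 hy2
  rw [dist_inv3_inv3 hx1 hy1] at h1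
  have d1 := dist_ne_zero.2 hx1
  have d2 := dist_ne_zero.2 hy1
  have d3 := dist_ne_zero.2 hx3
  have d4 := dist_ne_zero.2 hy3
  field_simp at h1 ⊢
  linear_combination 4 * h1

/-- The derivative of a map which is conformal, with factor `4 / Q`, off a finite set. -/
lemma mul_norm_hasFDerivAt_sq {F : E3 → E3} {Q : E3 → ℝ} {S : Set E3} (hS : S.Finite)
    (hQ : Continuous Q)
    (h : ∀ x y, x ∉ S → y ∉ S → Q x * Q y * dist (F x) (F y) ^ 2 = 16 * dist x y ^ 2)
    {A : E3 →L[ℝ] E3} {x : E3} (hF : HasFDerivAt F A x) (v : E3) :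
    (Q x * ‖A v‖) ^ 2 = 16 * ‖v‖ ^ 2 := by
  rcases eq_or_ne v 0 with rfl | hv
  · simp
  have hc : Tendsto (fun n : ℕ => ‖(n : ℝ)‖) atTop atTop := by
    simpa using tendsto_natCast_atTop_atTop (R := ℝ)
  have hev : ∀ u : E3, u ≠ 0 → ∀ᶠ n : ℕ in atTop, x + (n : ℝ)⁻¹ • u ∉ S := by
    intro u hu
    have hinj : Function.Injective fun n : ℕ => x + (n : ℝ)⁻¹ • u := by
      intro m n hmn
      simpa using smul_left_injective ℝ hu (add_left_cancel hmn)
    have := (hS.preimage hinj.injOn).compl_mem_cofinite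
    rwa [Nat.cofinite_eq_atTop] at this
  have hlim : ∀ u : E3, Tendsto (fun n : ℕ => Q (x + (n : ℝ)⁻¹ • u)) atTop (𝓝 (Q x)) := by
    intro u
    refine (hQ.tendsto x).comp ?_
    have := (tendsto_inv_atTop_nhds_zero_nat (𝕜 := ℝ)).smul_const u
    simpa using this.const_add x
  -- The points `x + v/n` and `x + 2v/n` are compared with each other, because `x` itself may lie in
  -- `S`; the value `F x` cancels.
  have hd := ((hlim ((2 : ℝ) • v)).mul (hlim v)).mul
    (((hF.lim ((2 : ℝ) • v) hc).sub (hF.lim v hc)).norm.pow 2)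
  rw [show A ((2 : ℝ) • v) - A v = A v by rw [map_smul]; module] at hd
  have heq : (fun n : ℕ => 16 * ‖v‖ ^ 2) =ᶠ[atTop] fun n : ℕ =>
      Q (x + (n : ℝ)⁻¹ • (2 : ℝ) • v) * Q (x + (n : ℝ)⁻¹ • v) *
        ‖(n : ℝ) • (F (x + (n : ℝ)⁻¹ • (2 : ℝ) • v) - F x)
          - (n : ℝ) • (F (x + (n : ℝ)⁻¹ • v) - F x)‖ ^ 2 := by
    filter_upwards [hev v hv, hev ((2 : ℝ) • v) (by simpa using hv), eventually_gt_atTop 0]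
      with n h1 h2 hn
    have hn' : (n : ℝ) ≠ 0 := by exact_mod_cast hn.ne'
    have e := h _ _ h2 h1
    have e2 : x + (n : ℝ)⁻¹ • (2 : ℝ) • v - (x + (n : ℝ)⁻¹ • v) = (n : ℝ)⁻¹ • v := by module
    rw [dist_eq_norm, dist_eq_norm, e2, norm_smul, mul_pow, norm_inv, inv_pow, Real.norm_eq_abs,
      sq_abs] at e
    rw [← smul_sub, sub_sub_sub_cancel_right, norm_smul, mul_pow, Real.norm_eq_abs, sq_abs]
    have hm := mul_inv_cancel₀ (pow_ne_zero 2 hn')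
    linear_combination -(n : ℝ) ^ 2 * e - 16 * ‖v‖ ^ 2 * hm
  have := tendsto_nhds_unique (hd.congr' heq.symm) tendsto_const_nhds
  linear_combination this

lemma continuous_confDenom (g : SL(2, ℂ)) : Continuous (confDenom g) := by
  unfold confDenom
  fun_prop

lemma frobSq_nonneg (g : SL(2, ℂ)) : 0 ≤ frobSq g := by
  unfold frobSq
  positivity

lemma two_le_frobSq (g : SL(2, ℂ)) : 2 ≤ frobSq g := by
  nlinarith [norm_axis_sq g, sq_nonneg ‖axis g‖, frobSq_nonneg g]

/-- Arithmetic–geometric mean, using `‖axis g‖² = (frobSq g - 2)(frobSq g + 2)`. -/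
lemma confDenom_nonneg (g : SL(2, ℂ)) (x : E3) : 0 ≤ confDenom g x := by
  have h1 := norm_axis_sq g
  have h2 := two_le_frobSq g
  have h3 : ‖axis g‖ ≤ frobSq g := le_of_sq_le_sq (by linarith) (frobSq_nonneg g)
  have h4 := real_inner_le_norm (axis g) x
  have h5 := norm_nonneg x
  have h6 : ‖axis g‖ ^ 2 * ‖x‖ ^ 2 = (frobSq g ^ 2 - 4) * ‖x‖ ^ 2 := by rw [h1]
  have h7 : ‖axis g‖ * ‖x‖ * 2 ≤ (frobSq g - 2) * ‖x‖ ^ 2 + (frobSq g + 2) := by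
    refine le_of_sq_le_sq ?_ (by nlinarith [mul_nonneg (sub_nonneg.2 h2) (sq_nonneg ‖x‖)])
    nlinarith [sq_nonneg ((frobSq g - 2) * ‖x‖ ^ 2 - (frobSq g + 2))]
  unfold confDenom
  linarith

/-- The equation of the isometric sphere. -/
lemma two_mul_inner_of_mem_isometricSphere {g : SL(2, ℂ)} {x : E3}
    (hx : x ∈ isometricSphere (ballAction g)) :
    2 * inner ℝ (axis g) x = (frobSq g - 2) * (‖x‖ ^ 2 + 1) := by
  have hx1 : ‖fderiv ℝ (finitePart (ballAction g)) x‖ = 1 := hx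
  have hdiff : DifferentiableAt ℝ (finitePart (ballAction g)) x := by
    by_contra h
    rw [fderiv_zero_of_not_differentiableAt h, norm_zero] at hx1
    exact zero_ne_one hx1
  have h1 := mul_norm_hasFDerivAt_sq (exceptionalSet_finite g) (continuous_confDenom g)
    (fun x y => dist_finitePart_ballAction) hdiff.hasFDerivAt
  have hQ := confDenom_nonneg g x
  have h2 : ∀ v, ‖fderiv ℝ (finitePart (ballAction g)) x v‖ = 4 / confDenom g x * ‖v‖ := by
    intro v
    have h3 : confDenom g x * ‖fderiv ℝ (finitePart (ballAction g)) x v‖ = 4 * ‖v‖ := by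
      rw [← sq_eq_sq₀ (by positivity) (by positivity), h1]
      ring
    have h0 : confDenom g x ≠ 0 := by
      intro h0
      have := h1 pole
      rw [h0, zero_mul, norm_sq_E3] at this
      simp [pole] at this
    field_simp
    linear_combination h3
  have : Nontrivial E3 := ⟨⟨pole, 0, fun h => by simpa [pole] using congrArg (·.snd) h⟩⟩
  have h3 := (ContinuousLinearMap.homothety_norm _ h2).symm.trans hx1
  -- The derivative is a homothety of ratio `4 / confDenom g x`.
  have h4 : confDenom g x = 4 := by
    have h0 : confDenom g x ≠ 0 := by
      intro h0
      simp [h0] at h3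
    field_simp at h3
    linarith
  unfold confDenom at h4
  linarith

/-! ### From contracted vectors to isometric disks -/

@[simp] lemma frobSq_inv (g : SL(2, ℂ)) : frobSq g⁻¹ = frobSq g := by
  simp only [frobSq, inv_apply_zero_zero, inv_apply_zero_one, inv_apply_one_zero,
    inv_apply_one_one, norm_neg]
  ring

/-- The direction of the centre of the isometric disk. -/
def isoDir (g : SL(2, ℂ)) : E3 := ‖axis g‖⁻¹ • axis g

/-- The height of the isometric circle. -/
def isoHeight (g : SL(2, ℂ)) : ℝ := (frobSq g - 2) / ‖axis g‖

variable {g : SL(2, ℂ)}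

lemma norm_axis_pos (hg : 2 < frobSq g) : 0 < ‖axis g‖ := by
  have := norm_axis_sq g
  refine lt_of_le_of_ne (norm_nonneg _) fun h => ?_
  rw [← h] at this
  nlinarith

lemma norm_isoDir (hg : 2 < frobSq g) : ‖isoDir g‖ = 1 := by
  rw [isoDir, norm_smul, norm_inv, norm_norm, inv_mul_cancel₀ (norm_axis_pos hg).ne']

lemma isoHeight_pos (hg : 2 < frobSq g) : 0 < isoHeight g :=
  div_pos (sub_pos.2 hg) (norm_axis_pos hg)

lemma isoHeight_lt_one (hg : 2 < frobSq g) : isoHeight g < 1 := by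
  rw [isoHeight, div_lt_one (norm_axis_pos hg)]
  refine lt_of_pow_lt_pow_left₀ 2 (norm_nonneg _) ?_
  rw [norm_axis_sq]
  nlinarith

lemma inner_isoDir (x : E3) : inner ℝ (isoDir g) x = inner ℝ (axis g) x / ‖axis g‖ := by
  rw [isoDir, real_inner_smul_left, inv_mul_eq_div]

lemma spherePt_mem_circle_iff (hg : 2 < frobSq g) {x y : ℂ} (h : ¬(x = 0 ∧ y = 0)) :
    spherePt x y ∈ sphereCircle (isoDir g) (isoHeight g)
      ↔ imageNormSq g x y = ‖x‖ ^ 2 + ‖y‖ ^ 2 := by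
  have h1 := inner_axis_spherePt g h
  rw [sphereCircle, Set.mem_ofPred_eq, inner_isoDir, isoHeight,
    div_left_inj' (norm_axis_pos hg).ne', h1, sub_right_inj, div_eq_iff (normSq_pos h).ne']
  simp [norm_spherePt h]

lemma spherePt_mem_disk_iff (hg : 2 < frobSq g) {x y : ℂ} (h : ¬(x = 0 ∧ y = 0)) :
    spherePt x y ∈ sphereDisk (isoDir g) (isoHeight g)
      ↔ imageNormSq g x y < ‖x‖ ^ 2 + ‖y‖ ^ 2 := by
  have h1 := inner_axis_spherePt g h
  rw [sphereDisk, Set.mem_ofPred_eq, inner_isoDir, isoHeight,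
    div_lt_div_iff_of_pos_right (norm_axis_pos hg), h1, sub_lt_sub_iff_left,
    div_lt_iff₀ (normSq_pos h)]
  simp [norm_spherePt h]

lemma contracts_of_le_inner_axis {x y : ℂ} (h : ¬(x = 0 ∧ y = 0))
    (hin : frobSq g - 2 ≤ inner ℝ (axis g) (spherePt x y)) : Contracts g x y := by
  rw [inner_axis_spherePt g h, sub_le_sub_iff_left, div_le_iff₀ (normSq_pos h)] at hin
  unfold Contracts
  linarith

lemma contracts_of_mem (hg : 2 < frobSq g) {x y : ℂ} (h : ¬(x = 0 ∧ y = 0))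
    (hp : spherePt x y ∈ sphereDisk (isoDir g) (isoHeight g) ∪
      sphereCircle (isoDir g) (isoHeight g)) : Contracts g x y := by
  rcases hp with hp | hp
  · exact ((spherePt_mem_disk_iff hg h).1 hp).le
  · exact ((spherePt_mem_circle_iff hg h).1 hp).le

lemma inv_image_fst (g : SL(2, ℂ)) (x y : ℂ) :
    g⁻¹ 0 0 * (g 0 0 * x + g 0 1 * y) + g⁻¹ 0 1 * (g 1 0 * x + g 1 1 * y) = x := by
  simp only [inv_apply_zero_zero, inv_apply_zero_one]
  linear_combination x * det_eq_one g

lemma inv_image_snd (g : SL(2, ℂ)) (x y : ℂ) :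
    g⁻¹ 1 0 * (g 0 0 * x + g 0 1 * y) + g⁻¹ 1 1 * (g 1 0 * x + g 1 1 * y) = y := by
  simp only [inv_apply_one_zero, inv_apply_one_one]
  linear_combination y * det_eq_one g

lemma imageNormSq_inv_image (g : SL(2, ℂ)) (x y : ℂ) :
    imageNormSq g⁻¹ (g 0 0 * x + g 0 1 * y) (g 1 0 * x + g 1 1 * y) = ‖x‖ ^ 2 + ‖y‖ ^ 2 := by
  rw [imageNormSq, inv_image_fst, inv_image_snd]

lemma exists_image_mem_circle (hg : 2 < frobSq g) {p : E3}
    (hp : p ∈ sphereCircle (isoDir g) (isoHeight g)) :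
    ∃ q ∈ sphereCircle (isoDir g⁻¹) (isoHeight g⁻¹),
      ballAction g p = (q : OnePoint E3) ∧ ballAction g⁻¹ q = (p : OnePoint E3) := by
  obtain ⟨x, y, h, rfl⟩ := exists_spherePt hp.1
  have h' := image_ne_zero g h
  refine ⟨_, ?_, ballAction_spherePt g h, ?_⟩
  · rw [spherePt_mem_circle_iff (by simpa using hg) h', imageNormSq_inv_image]
    exact ((spherePt_mem_circle_iff hg h).1 hp).symm
  · rw [ballAction_spherePt _ h', inv_image_fst, inv_image_snd]

lemma image_circle (hg : 2 < frobSq g) :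
    ballAction g '' ((↑) '' sphereCircle (isoDir g) (isoHeight g))
      = (↑) '' sphereCircle (isoDir g⁻¹) (isoHeight g⁻¹) := by
  apply Set.Subset.antisymm
  · rintro _ ⟨_, ⟨p, hp, rfl⟩, rfl⟩
    obtain ⟨q, hq, e, -⟩ := exists_image_mem_circle hg hp
    exact ⟨q, hq, e.symm⟩
  · rintro _ ⟨q, hq, rfl⟩
    obtain ⟨p, hp, -, e⟩ := exists_image_mem_circle (g := g⁻¹) (by simpa using hg) hq
    rw [inv_inv] at hp e
    exact ⟨p, ⟨p, hp, rfl⟩, e⟩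

/-- A vector strictly contracted by `g` has an image strictly expanded by `g⁻¹`. -/
lemma disjoint_image_disk (hg : 2 < frobSq g) :
    Disjoint (ballAction g '' ((↑) '' sphereDisk (isoDir g) (isoHeight g)))
      ((↑) '' sphereDisk (isoDir g⁻¹) (isoHeight g⁻¹)) := by
  rw [Set.disjoint_left]
  rintro _ ⟨_, ⟨p, hp, rfl⟩, rfl⟩ ⟨q, hq, e⟩
  obtain ⟨x, y, h, rfl⟩ := exists_spherePt hp.1
  have h' := image_ne_zero g h
  rw [ballAction_spherePt g h, OnePoint.coe_eq_coe] at e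
  rw [e, spherePt_mem_disk_iff (by simpa using hg) h', imageNormSq_inv_image] at hq
  exact ((spherePt_mem_disk_iff hg h).1 hp).not_gt hq

/-- The radial projection of an isometric sphere to the unit sphere lies in the isometric disk. -/
lemma le_inner_axis_of_mem_isometricSphere (hg : 2 < frobSq g) {x : E3}
    (hx : x ∈ isometricSphere (ballAction g)) :
    x ≠ 0 ∧ frobSq g - 2 ≤ inner ℝ (axis g) (‖x‖⁻¹ • x) := by
  have h1 := two_mul_inner_of_mem_isometricSphere hx
  have h0 : x ≠ 0 := by
    rintro rfl
    rw [inner_zero_right, norm_zero] at h1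
    linarith
  have hn := norm_pos_iff.2 h0
  refine ⟨h0, ?_⟩
  rw [inner_smul_right, inv_mul_eq_div, le_div_iff₀ hn]
  -- This is `‖x‖² + 1 ≥ 2 ‖x‖` in the equation of the sphere.
  nlinarith [mul_nonneg (sub_pos.2 hg).le (sq_nonneg (‖x‖ - 1))]

/-! ### Classical generators and disjoint isometric spheres -/

namespace HaveDisjointContractedVectors

variable {ι : Type} {G : ι → SL(2, ℂ)}

/-- If `frobSq` equals `2`, the axis vanishes and both `g` and `g⁻¹` contract `(1, 0)`. The strict
inequality makes the isometric disks nondegenerate. -/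
lemma two_lt_frobSq (h : HaveDisjointContractedVectors G) (i : ι) : 2 < frobSq (G i) := by
  refine lt_of_le_of_ne (two_le_frobSq _) fun h2 => ?_
  have key : ∀ g : SL(2, ℂ), frobSq g = 2 → Contracts g 1 0 := by
    intro g hg
    refine contracts_of_le_inner_axis (by simp) ?_
    have h0 := norm_axis_sq g
    rw [hg] at h0
    have : axis g = 0 := by
      rw [← norm_eq_zero, ← sq_eq_zero_iff]
      linarith
    rw [this, inner_zero_left, hg]
    norm_num
  exact one_ne_zero (h (.inl i) (.inr i) Sum.inl_ne_inr 1 0 (key _ h2.symm)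
    (key _ ((frobSq_inv _).trans h2.symm))).1

lemma two_lt_frobSq_sum (h : HaveDisjointContractedVectors G) (s : ι ⊕ ι) :
    2 < frobSq (Sum.elim G (fun i => (G i)⁻¹) s) := by
  rcases s with i | i
  · exact h.two_lt_frobSq i
  · exact (h.two_lt_frobSq i).trans_eq (frobSq_inv _).symm

/-- The isometric disks show that the generators are classical. -/
lemma areClassicalGenerators (h : HaveDisjointContractedVectors G) :
    AreClassicalGenerators fun i => ballAction (G i) := by
  have h2 := h.two_lt_frobSq_sum
  have hb : ∀ g : SL(2, ℂ), 2 < frobSq g → ‖isoDir g‖ = 1 ∧ -1 < isoHeight g ∧ isoHeight g < 1 :=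
    fun g hg => ⟨norm_isoDir hg, by linarith [isoHeight_pos hg], isoHeight_lt_one hg⟩
  refine ⟨fun i => isoDir (G i), fun i => isoDir (G i)⁻¹, fun i => isoHeight (G i),
    fun i => isoHeight (G i)⁻¹, fun i => hb _ (h2 (.inl i)), fun i => hb _ (h2 (.inr i)), ?_,
    fun i => ⟨image_circle (h2 (.inl i)), disjoint_image_disk (h2 (.inl i))⟩⟩
  intro s t hst
  have e1 : ∀ s : ι ⊕ ι, Sum.elim (fun i => isoDir (G i)) (fun i => isoDir (G i)⁻¹) s
      = isoDir (Sum.elim G (fun i => (G i)⁻¹) s) := by rintro (i | i) <;> rfl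
  have e2 : ∀ s : ι ⊕ ι, Sum.elim (fun i => isoHeight (G i)) (fun i => isoHeight (G i)⁻¹) s
      = isoHeight (Sum.elim G (fun i => (G i)⁻¹) s) := by rintro (i | i) <;> rfl
  rw [e1, e1, e2, e2, Set.disjoint_left]
  intro p hp hp'
  have hn : ‖p‖ = 1 := hp.elim (·.1) (·.1)
  obtain ⟨x, y, h0, rfl⟩ := exists_spherePt hn
  exact h0 (h s t hst x y (contracts_of_mem (h2 s) h0 hp) (contracts_of_mem (h2 t) h0 hp'))

lemma haveDisjointIsometricSpheres (h : HaveDisjointContractedVectors G) :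
    HaveDisjointIsometricSpheres G := by
  intro s t hst
  rw [Set.disjoint_left]
  intro p hp hp'
  obtain ⟨hp0, h1⟩ := le_inner_axis_of_mem_isometricSphere (h.two_lt_frobSq_sum s) hp
  obtain ⟨-, h2⟩ := le_inner_axis_of_mem_isometricSphere (h.two_lt_frobSq_sum t) hp'
  have hn : ‖‖p‖⁻¹ • p‖ = 1 := by
    rw [norm_smul, norm_inv, norm_norm, inv_mul_cancel₀ (norm_ne_zero_iff.2 hp0)]
  obtain ⟨x, y, h0, e⟩ := exists_spherePt hn
  rw [e] at h1 h2
  exact h0 (h s t hst x y (contracts_of_le_inner_axis h0 h1) (contracts_of_le_inner_axis h0 h2))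

end HaveDisjointContractedVectors

end SchottkyBall

end

open SchottkyBall in
theorem mainTheorem8 (k : ℕ) (lam : ℕ → ℂ) (α : ℕ → SL(2, ℂ)) (β : ℕ → Fin k → SL(2, ℂ))
    (Γ : ℕ → Subgroup PSL2C)
    (hΓ : ∀ n, IsSchottkyGroup (Γ n))
    (hgen : ∀ n, Γ n = generatedBy (Fin.cons (α n) (β n) : Fin (k + 1) → SL(2, ℂ)))
    (hα : ∀ n, (α n : Matrix (Fin 2) (Fin 2) ℂ) = !![lam n, 0; 0, (lam n)⁻¹])
    (hlam : ∀ n, 1 < ‖lam n‖)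
    (htr : ∀ i, Tendsto (fun n => ‖tr (β n i)‖) atTop atTop)
    (hcond :
      (∃ L : ℝ, 1 < L ∧ (∀ᶠ n in atTop, ‖lam n‖ < L) ∧
        AnnulusConditions β (fun n => ‖lam n‖)) ∨
      (∃ κ : ℝ, 0 < κ ∧ (∀ᶠ n in atTop, κ < ‖lam n‖) ∧
        AnnulusConditions β (fun _ => κ))) :
    ∃ φ : ℕ → ℕ, StrictMono φ ∧ ∀ᶠ m in atTop,
      AreClassicalGenerators (fun i : Fin (k + 1) =>
        ballAction ((Fin.cons (α (φ m)) (β (φ m)) : Fin (k + 1) → SL(2, ℂ)) i)) ∧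
      HaveDisjointIsometricSpheres
        (Fin.cons (α (φ m)) (β (φ m)) : Fin (k + 1) → SL(2, ℂ)) := by
  have key : ∃ᶠ n in atTop, HaveDisjointContractedVectors
      (Fin.cons (α n) (β n) : Fin (k + 1) → SL(2, ℂ)) := by
    rcases hcond with ⟨L, -, hL, h⟩ | ⟨κ, hκ, hl, h⟩
    -- The upper bound on `|λ|` makes the separation threshold uniform in `n`.
    · refine (h.frequently_isWellSeparated (L := L)
        (.of_forall fun n => one_pos.trans (hlam n)) (hL.mono fun n hn => hn.le) htr).mono ?_
      exact fun n hn => hn.haveDisjointContractedVectors (hlam n) le_rfl (hα n)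
    -- The fixed radius `κ` is its own bound; `κ < |λ|` puts the disks of the diagonal generator
    -- outside the annulus.
    · refine ((h.frequently_isWellSeparated (L := κ) (.of_forall fun _ => hκ)
        (.of_forall fun _ => le_rfl) htr).and_eventually hl).mono ?_
      exact fun n hn => hn.1.haveDisjointContractedVectors (hlam n) hn.2.le (hα n)
  obtain ⟨φ, hφ, h⟩ := extraction_of_frequently_atTop key
  exact ⟨φ, hφ, .of_forall fun m =>
    ⟨(h m).areClassicalGenerators, (h m).haveDisjointIsometricSpheres⟩⟩
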